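/- **Model.** Let $V=V_1\sqcup V_2$ be a finite vertex set with $n=|V|$, and let $d:V\to\{2,3,\dots\}$ be such that $N_i=\sum_{v\in V_i}d(v)$ is even for $i=1,2$; put $N=N_1+N_2$. Let $p$ be an even integer with $2\le p\le\min\{N_1,N_2\}$. Attach $d(v)$ half-edges to every $v\in V$. In each community choose $p$ half-edges uniformly at random and call them outgoing; call the remaining ones internal. Match the outgoing half-edges of $V_1$ with those of $V_2$ by a uniformly random bijection and, for each $i$, match the internal half-edges of $V_i$ by a uniformly random perfect matching (all choices being independent given the previous ones). The resulting random multigraph $G$ is the two communities random graph. Put $\alpha=\frac{p}{N_1}+\frac{p}{N_2}$. **Spectral profile.** Let $P$ be the transition matrix of the lazy simple random walk on $G$ (with probability $1/2$ stay; otherwise move along a uniformly chosen half-edge at the current vertex), which is reversible with respect to $\pi(x)=d(x)/N$. For nonempty $A\subseteq V$ let $P_A$ be the restriction of $P$ to $A$ and $\lambda(A)=1-\max\{\mu:\mu\text{ is an eigenvalue of }P_A\}$. With $\pi_*=\min_x\pi(x)$ let $$\Lambda(r)=\inf\{\lambda(A):\ \pi_*\le\pi(A)\le r\}.$$ **Proposition.**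 For every $\Delta\in\mathbb N$, $\kappa>0$ and $a>0$ there is a constant $c=c(\Delta,\kappa,a)>0$ such that the following holds. Let $(G_k)_{k\ge 0}$ be a sequence of two communities random graphs whose parameters satisfy $n_k=|V^{(k)}|\to\infty$ and, for every $k$, $$\alpha_k\le 1,\qquad \min\{N_1^{(k)},N_2^{(k)}\}\ge\kappa N^{(k)},\qquad 3\le d^{(k)}(v)\le\Delta\ \text{ for all } v\in V^{(k)},\qquad \alpha_k\ge\frac{a}{\log n_k}.$$ Then $$\mathbb P\big(\Lambda_{G_k}(1/2)\ge c\,\alpha_k\big)\longrightarrow 1\qquad\text{as }k\to\infty .$$ In other words, with high probability every nonempty set of vertices of stationary measure at most $1/2$ has Dirichlet eigenvalue at least $c\,\alpha_k$. -/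

import Mathlib

open Filter Topology
open scoped ENNReal

universe u

noncomputable section

/-! ### Dirichlet eigenvalues and the spectral profile of a finite chain -/

/-- The Dirichlet eigenvalue `λ(A) = 1 - max {μ : μ eigenvalue of P_A}`, where `P_A` is the
restriction of the transition matrix `P` to `A`. (For a reversible chain and nonempty `A` the set of
real eigenvalues of `P_A` is finite and nonempty, so the supremum is a maximum.) -/
def dirichletEigenvalue {S : Type u} [Fintype S] [DecidableEq S] (P : Matrix S S ℝ)
    (A : Finset S) : ℝ :=
  1 - sSup {μ : ℝ | Module.End.HasEigenvalue
    (Matrix.toLin' (P.submatrix (fun x : A => (x : S)) (fun x : A => (x : S)))) μ}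

/-- The spectral profile `Λ(r) = inf {λ(A) : π_* ≤ π(A) ≤ r}`, with `π_* = min_x π(x)`. -/
def spectralProfile {S : Type u} [Fintype S] [DecidableEq S] (P : Matrix S S ℝ) (π : S → ℝ)
    (r : ℝ) : ℝ :=
  sInf (dirichletEigenvalue P ''
    {A : Finset S | (⨅ x, π x) ≤ ∑ x ∈ A, π x ∧ ∑ x ∈ A, π x ≤ r})

/-! ### Perfect matchings of a finite set -/

/-- A perfect matching of `X`, given as the map sending each element to its partner. -/
abbrev PerfectMatching (X : Type u) : Type u :=
  {m : X → X // ∀ x, m (m x) = x ∧ m x ≠ x}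

theorem PerfectMatching.nonempty_of_even {X : Type u} [Fintype X] (h : Even (Fintype.card X)) :
    Nonempty (PerfectMatching X) := by
  obtain ⟨k, hk⟩ := h
  have e : X ≃ Fin k × Bool := Fintype.equivOfCardEq (by simp [hk, mul_two])
  refine ⟨⟨fun x => e.symm ((e x).1, !(e x).2), fun x => ⟨by simp, fun hx => ?_⟩⟩⟩
  have h2 := congrArg (fun y => (e y).2) hx
  simp at h2

/-! ### The two communities random graph -/

/-- The deterministic data of the two communities model: the two communities, the degrees and the
number `p` of outgoing half-edges in each community. -/
structure TwoCommunities : Type (u + 1) where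
  V₁ : Type u
  V₂ : Type u
  [fintype₁ : Fintype V₁]
  [fintype₂ : Fintype V₂]
  [decEq₁ : DecidableEq V₁]
  [decEq₂ : DecidableEq V₂]
  d₁ : V₁ → ℕ
  d₂ : V₂ → ℕ
  two_le_d₁ : ∀ v, 2 ≤ d₁ v
  two_le_d₂ : ∀ v, 2 ≤ d₂ v
  even_N₁ : Even (∑ v, d₁ v)
  even_N₂ : Even (∑ v, d₂ v)
  p : ℕ
  even_p : Even p
  two_le_p : 2 ≤ p
  p_le_N₁ : p ≤ ∑ v, d₁ v
  p_le_N₂ : p ≤ ∑ v, d₂ v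

namespace TwoCommunities

attribute [instance] fintype₁ fintype₂ decEq₁ decEq₂

variable (M : TwoCommunities.{u})

/-- The vertex set, the disjoint union of the two communities. -/
abbrev V : Type u := M.V₁ ⊕ M.V₂

/-- The degree of a vertex. -/
def d : M.V → ℕ := Sum.elim M.d₁ M.d₂

/-- The number of vertices. -/
def n : ℕ := Fintype.card M.V

def N₁ : ℕ := ∑ v, M.d₁ v

def N₂ : ℕ := ∑ v, M.d₂ v

def N : ℕ := M.N₁ + M.N₂

/-- `α = α₁ + α₂` with `αᵢ = p / Nᵢ`. -/
def α : ℝ := (M.p : ℝ) / M.N₁ + (M.p : ℝ) / M.N₂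

/-- The half-edges of the first community. -/
abbrev H₁ : Type u := Σ v : M.V₁, Fin (M.d₁ v)

/-- The half-edges of the second community. -/
abbrev H₂ : Type u := Σ v : M.V₂, Fin (M.d₂ v)

/-- All half-edges. -/
abbrev H : Type u := M.H₁ ⊕ M.H₂

/-- The vertex to which a half-edge is attached. -/
def vertex : M.H → M.V := Sum.map Sigma.fst Sigma.fst

/-- The possible sets of outgoing half-edges in the first community. -/
abbrev Outgoing₁ : Type u := {O : Finset M.H₁ // O.card = M.p}

/-- The possible sets of outgoing half-edges in the second community. -/
abbrev Outgoing₂ : Type u := {O : Finset M.H₂ // O.card = M.p}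

instance : Nonempty M.Outgoing₁ := by
  obtain ⟨O, -, hO⟩ := Finset.exists_subset_card_eq
    (s := (Finset.univ : Finset M.H₁)) (n := M.p) (by simpa using M.p_le_N₁)
  exact ⟨⟨O, hO⟩⟩

instance : Nonempty M.Outgoing₂ := by
  obtain ⟨O, -, hO⟩ := Finset.exists_subset_card_eq
    (s := (Finset.univ : Finset M.H₂)) (n := M.p) (by simpa using M.p_le_N₂)
  exact ⟨⟨O, hO⟩⟩

variable {M}

/-- The internal half-edges of the first community. -/
abbrev Internal₁ (O : M.Outgoing₁) : Type u := {h : M.H₁ // h ∉ O.1}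

/-- The internal half-edges of the second community. -/
abbrev Internal₂ (O : M.Outgoing₂) : Type u := {h : M.H₂ // h ∉ O.1}

instance (O₁ : M.Outgoing₁) (O₂ : M.Outgoing₂) : Nonempty (O₁.1 ≃ O₂.1) :=
  ⟨Finset.equivOfCardEq (O₁.2.trans O₂.2.symm)⟩

instance (O : M.Outgoing₁) : Nonempty (PerfectMatching (Internal₁ O)) := by
  apply PerfectMatching.nonempty_of_even
  rw [Fintype.card_subtype_compl, Fintype.card_coe, O.2]
  simpa using (Nat.even_sub M.p_le_N₁).2 (by simp [M.even_N₁, M.even_p])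

instance (O : M.Outgoing₂) : Nonempty (PerfectMatching (Internal₂ O)) := by
  apply PerfectMatching.nonempty_of_even
  rw [Fintype.card_subtype_compl, Fintype.card_coe, O.2]
  simpa using (Nat.even_sub M.p_le_N₂).2 (by simp [M.even_N₂, M.even_p])

/-- The pairing of all half-edges given by a matching of the outgoing half-edges of the two
communities and perfect matchings of the internal half-edges in each community. -/
def pairing (O₁ : M.Outgoing₁) (O₂ : M.Outgoing₂) (b : O₁.1 ≃ O₂.1)
    (m₁ : PerfectMatching (Internal₁ O₁)) (m₂ : PerfectMatching (Internal₂ O₂)) : M.H → M.H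
  | Sum.inl h => if hh : h ∈ O₁.1 then Sum.inr (b ⟨h, hh⟩) else Sum.inl (m₁.1 ⟨h, hh⟩)
  | Sum.inr h => if hh : h ∈ O₂.1 then Sum.inl (b.symm ⟨h, hh⟩) else Sum.inr (m₂.1 ⟨h, hh⟩)

variable (M)

/-- The law of the random graph, as the random pairing of the half-edges: choose `p` outgoing
half-edges uniformly in each community, match the outgoing half-edges of the two communities
uniformly at random, and take uniform perfect matchings of the internal half-edges. -/
def law : PMF (M.H → M.H) :=
  (PMF.uniformOfFintype M.Outgoing₁).bind fun O₁ =>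
  (PMF.uniformOfFintype M.Outgoing₂).bind fun O₂ =>
  (PMF.uniformOfFintype (O₁.1 ≃ O₂.1)).bind fun b =>
  (PMF.uniformOfFintype (PerfectMatching (Internal₁ O₁))).bind fun m₁ =>
  (PMF.uniformOfFintype (PerfectMatching (Internal₂ O₂))).map fun m₂ =>
    pairing O₁ O₂ b m₁ m₂

variable {M}

/-- The transition matrix of the lazy simple random walk on the multigraph given by the pairing `σ`:
with probability `1/2` stay put, otherwise move along a uniformly chosen half-edge at `x` to the
vertex of its partner. -/
def lazyWalk (σ : M.H → M.H) : Matrix M.V M.V ℝ := fun x y =>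
  (if x = y then 1 / 2 else 0) +
    1 / 2 * (((Finset.univ.filter fun h : M.H =>
      M.vertex h = x ∧ M.vertex (σ h) = y).card : ℝ) / M.d x)

variable (M)

/-- The stationary distribution `π(x) = d(x) / N` of the walk. -/
def stationary (x : M.V) : ℝ := (M.d x : ℝ) / M.N

end TwoCommunities

end

open scoped symmDiff

/-!
Conditionally on a good event, a Poincaré inequality with constant of order `p / N` gives the bound.
The good event says that all sets of vertices which fill at most half of each community expand, and
so do their symmetric differences with the first community; below size `p / 2` the latter is
automatic, as the first community has `2 * p` boundary half-edges. For the inequality, let the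
nonnegative function `f` vanish on at least half of one community, and let `m` be a median of `f` on
the other. Cutting `f` at its level sets compares it with `m` on one community and with `0` on the
other, and the two communities are compared through the `p` edges between them, which contribute
`p * m ^ 2`. The level sets below `m` are twisted by the community that has median `m`.

The good event is likely by a Chernoff and union bound. The law of the pairing is invariant under
the permutations of each community, so the probability generating function of the edge boundary of
`S` only depends on the sizes of the two parts of `S` and is an average over all sets with these
sizes. For a fixed pairing a weighted sum over all sets factors over the edges, and an edge with
weights `a` and `b` at its ends contributes at most `√((1 + a ^ 2) * (1 + b ^ 2))`, up to a factor
close to one. If `W` is the exponential of the entropy of the choice of `S`, this gives the bound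
`W ^ (-1/2 + 1/12)` for the probability, up to a factor polynomial in the size of `S`. It beats the
number of sets of vertices with the same volume in each community: as all degrees are at least `3`,
there are at most `W ^ (1/3)` of them.
-/

noncomputable section

section EdgeBoundary

variable {H : Type*} [Fintype H] [DecidableEq H] {σ : H → H} {S T : Finset H}

/-- The edge boundary of a set `S` of half-edges under the pairing `σ`, encoded as the set of
half-edges whose edge has exactly one end in `S`: each boundary edge contributes two elements. -/
def edgeBoundary (σ : H → H) (S : Finset H) : Finset H := {h | ¬(h ∈ S ↔ σ h ∈ S)}

theorem mem_edgeBoundary {h : H} : h ∈ edgeBoundary σ S ↔ ¬(h ∈ S ↔ σ h ∈ S) := by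
  simp [edgeBoundary]

theorem edgeBoundary_compl : edgeBoundary σ Sᶜ = edgeBoundary σ S := by
  ext h
  simp only [mem_edgeBoundary, Finset.mem_compl, not_iff_not]

theorem edgeBoundary_symmDiff (σ : H → H) (S T : Finset H) :
    edgeBoundary σ (S ∆ T) = edgeBoundary σ S ∆ edgeBoundary σ T := by
  ext h
  simp only [mem_edgeBoundary, Finset.mem_symmDiff]
  tauto

theorem card_edgeBoundary_le (hσ : Function.Injective σ) (S : Finset H) :
    (edgeBoundary σ S).card ≤ 2 * S.card := by
  have hsub : edgeBoundary σ S ⊆ S ∪ Finset.univ.filter (fun h => σ h ∈ S) := fun h hh => by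
    simp only [mem_edgeBoundary, Finset.mem_union, Finset.mem_filter_univ] at hh ⊢
    tauto
  have hpre : (Finset.univ.filter fun h => σ h ∈ S).card ≤ S.card :=
    Finset.card_le_card_of_injOn σ (by simp [Set.MapsTo]) hσ.injOn
  have := (Finset.card_le_card hsub).trans (Finset.card_union_le _ _)
  omega

theorem card_edgeBoundary_le_add (σ : H → H) (S T : Finset H) :
    (edgeBoundary σ T).card ≤ (edgeBoundary σ (S ∆ T)).card + (edgeBoundary σ S).card := by
  have hsub : edgeBoundary σ T ⊆ edgeBoundary σ (S ∆ T) ∪ edgeBoundary σ S := fun h hh => by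
    simp only [mem_edgeBoundary, Finset.mem_symmDiff, Finset.mem_union] at hh ⊢
    tauto
  exact (Finset.card_le_card hsub).trans (Finset.card_union_le _ _)

end EdgeBoundary

section Coarea

open MeasureTheory

variable {ι κ : Type*} [Fintype ι] [Fintype κ]

/-- The number of coordinates in which exactly one of `a` and `b` exceeds the level `t`. -/
def levelDist (a b : ι → ℝ) (t : ℝ) : ℕ :=
  (Finset.univ.filter fun i => ¬(t < a i ↔ t < b i)).card

theorem levelDist_sumElim (a b : ι → ℝ) (a' b' : κ → ℝ) (t : ℝ) :
    levelDist (Sum.elim a a') (Sum.elim b b') t = levelDist a b t + levelDist a' b' t := by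
  simp only [levelDist, Finset.card_filter, Fintype.sum_sum_type]
  rfl

theorem levelDist_const_zero (c : ℝ) {t : ℝ} (ht : 0 ≤ t) :
    levelDist (fun _ : ι => c) 0 t = if t < c then Fintype.card ι else 0 := by
  simp only [levelDist, Pi.zero_apply, ht.not_gt, iff_false, not_not]
  split_ifs with h <;> simp [h]

theorem levelDist_ite_of_lt [DecidableEq ι] (a : ι → ℝ) (X : Finset ι) {c t : ℝ} (ht : 0 ≤ t)
    (htc : t < c) :
    levelDist a (fun i => if i ∈ X then c else 0) t =
      ((Finset.univ.filter fun i => t < a i) ∆ X).card := by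
  rw [levelDist]
  congr 1
  ext i
  by_cases hi : i ∈ X <;> simp [Finset.mem_symmDiff, hi, htc, ht.not_gt]

theorem levelDist_ite_of_ge [DecidableEq ι] (a : ι → ℝ) (X : Finset ι) {c t : ℝ} (ht : 0 ≤ t)
    (hct : c ≤ t) :
    levelDist a (fun i => if i ∈ X then c else 0) t =
      (Finset.univ.filter fun i => t < a i).card := by
  rw [levelDist]
  congr 1
  ext i
  by_cases hi : i ∈ X <;> simp [hi, hct.not_gt, ht.not_gt]

theorem levelDist_eq_sum_indicator (a b : ι → ℝ) (t : ℝ) :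
    (levelDist a b t : ℝ) =
      ∑ i, (Set.Ico (min (a i) (b i)) (max (a i) (b i))).indicator (1 : ℝ → ℝ) t := by
  rw [levelDist, Finset.natCast_card_filter]
  refine Finset.sum_congr rfl fun i _ => ?_
  simp only [Set.indicator_apply, Set.mem_Ico, min_le_iff, lt_max_iff, Pi.one_apply]
  grind

theorem integrable_levelDist (a b : ι → ℝ) (μ : Measure ℝ) [IsLocallyFiniteMeasure μ] :
    Integrable (fun t => (levelDist a b t : ℝ)) μ := by
  simp only [levelDist_eq_sum_indicator]
  exact integrable_finsetSum _ fun i _ =>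
    (integrable_indicator_iff measurableSet_Ico).2 (integrableOn_const measure_Ico_lt_top.ne)

theorem integral_levelDist {a b : ι → ℝ} (ha : 0 ≤ a) (hb : 0 ≤ b) :
    ∫ t in Set.Ici (0 : ℝ), (levelDist a b t : ℝ) = ∑ i, |a i - b i| := by
  simp only [levelDist_eq_sum_indicator]
  rw [integral_finsetSum _ fun i _ =>
    (integrable_indicator_iff measurableSet_Ico).2 (integrableOn_const measure_Ico_lt_top.ne)]
  refine Finset.sum_congr rfl fun i _ => ?_
  have hsub : Set.Ico (min (a i) (b i)) (max (a i) (b i)) ⊆ Set.Ici 0 :=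
    fun t ht => (le_min (ha i) (hb i)).trans ht.1
  rw [integral_indicator_one measurableSet_Ico, measureReal_restrict_apply measurableSet_Ico,
    Set.inter_eq_left.2 hsub, Real.volume_real_Ico_of_le min_le_max, max_sub_min_eq_abs']

theorem mul_sum_abs_sub_le_of_levelDist {a b : ι → ℝ} {a' b' : κ → ℝ} (ha : 0 ≤ a) (hb : 0 ≤ b)
    (ha' : 0 ≤ a') (hb' : 0 ≤ b') {ε : ℝ}
    (h : ∀ t, 0 ≤ t → ε * levelDist a b t ≤ levelDist a' b' t) :
    ε * ∑ i, |a i - b i| ≤ ∑ j, |a' j - b' j| := by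
  rw [← integral_levelDist ha hb, ← integral_levelDist ha' hb', ← integral_const_mul]
  exact setIntegral_mono_on ((integrable_levelDist _ _ _).const_mul ε)
    (integrable_levelDist _ _ _) measurableSet_Ici h

end Coarea

section ProfileMap

variable {m s t : ℝ}

/-- The truncation of the two-community Poincaré inequality: it grows quadratically at `0`, so as to
compare with `0` on one community, and it differs from `m ^ 2` by a quadratic amount at the median
`m`, so as to compare with `m ^ 2` on the other one. -/
def profileMap (m t : ℝ) : ℝ :=
  if t ≤ m then 3 * t ^ 2 - 2 * t ^ 3 / m else m ^ 2 + (t - m) ^ 2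

theorem profileMap_of_le (h : t ≤ m) : profileMap m t = 3 * t ^ 2 - 2 * t ^ 3 / m := if_pos h

theorem profileMap_of_ge (hm : 0 ≤ m) (h : m ≤ t) : profileMap m t = m ^ 2 + (t - m) ^ 2 := by
  rcases h.eq_or_lt with rfl | h
  · rw [profileMap_of_le le_rfl]
    rcases hm.eq_or_lt with rfl | hm
    · simp
    · field_simp
      ring
  · exact if_neg h.not_ge

theorem profileMap_zero (hm : 0 ≤ m) : profileMap m 0 = 0 := by
  simp [profileMap_of_le hm]

theorem sq_le_profileMap (ht : 0 ≤ t) (h : t ≤ m) : t ^ 2 ≤ profileMap m t := by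
  rw [profileMap_of_le h]
  have : 2 * t ^ 3 / m ≤ 2 * t ^ 2 :=
    div_le_of_le_mul₀ (ht.trans h) (by positivity) (by nlinarith [sq_nonneg t])
  linarith

theorem profileMap_le_sq_sub (ht : 0 ≤ t) (h : t ≤ m) :
    profileMap m t ≤ m ^ 2 - (m - t) ^ 2 := by
  rw [profileMap_of_le h]
  rcases (ht.trans h).eq_or_lt with rfl | hm
  · simp [le_antisymm h ht]
  · have : 4 * t ^ 2 - 2 * m * t ≤ 2 * t ^ 3 / m := by
      rw [le_div_iff₀ hm]
      nlinarith [mul_nonneg ht (sq_nonneg (m - t))]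
    linarith

theorem sq_sub_le_profileMap (ht : 0 ≤ t) (h : t ≤ m) :
    m ^ 2 - 3 * (m - t) ^ 2 ≤ profileMap m t := by
  rw [profileMap_of_le h]
  have : 2 * t ^ 3 / m ≤ 2 * m ^ 2 - 6 * m * t + 6 * t ^ 2 :=
    div_le_of_le_mul₀ (ht.trans h) (by nlinarith [sq_nonneg (2 * m - 3 * t), sq_nonneg t])
      (by nlinarith [pow_nonneg (sub_nonneg.2 h) 3])
  linarith

theorem half_sq_le_profileMap (hm : 0 ≤ m) (ht : 0 ≤ t) : t ^ 2 / 2 ≤ profileMap m t := by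
  rcases le_total t m with h | h
  · linarith [sq_le_profileMap ht h, sq_nonneg t]
  · rw [profileMap_of_ge hm h]
    linarith [sq_nonneg (t - 2 * m)]

theorem profileMap_nonneg (hm : 0 ≤ m) (ht : 0 ≤ t) : 0 ≤ profileMap m t :=
  (by positivity : 0 ≤ t ^ 2 / 2).trans (half_sq_le_profileMap hm ht)

theorem sq_sub_le_abs_profileMap_sub (hm : 0 ≤ m) (ht : 0 ≤ t) :
    (t - m) ^ 2 ≤ |profileMap m t - m ^ 2| := by
  rcases le_total t m with h | h
  · rw [abs_sub_comm]
    refine le_trans ?_ (le_abs_self _)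
    linarith [profileMap_le_sq_sub ht h]
  · rw [profileMap_of_ge hm h, add_sub_cancel_left]
    exact le_abs_self _

theorem sq_lt_profileMap_iff (hm : 0 ≤ m) (ht : 0 ≤ t) : m ^ 2 < profileMap m t ↔ m < t := by
  refine ⟨fun h => ?_, fun h => ?_⟩
  · by_contra! hle
    linarith [profileMap_le_sq_sub ht hle, sq_nonneg (m - t)]
  · rw [profileMap_of_ge hm h.le]
    exact lt_add_of_pos_right _ (pow_pos (sub_pos.2 h) 2)

theorem profileMap_lt_sq_iff (hm : 0 ≤ m) (ht : 0 ≤ t) : profileMap m t < m ^ 2 ↔ t < m := by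
  refine ⟨fun h => ?_, fun h => ?_⟩
  · by_contra! hle
    rw [profileMap_of_ge hm hle] at h
    linarith [sq_nonneg (t - m)]
  · linarith [profileMap_le_sq_sub ht h.le, pow_pos (sub_pos.2 h) 2]

theorem abs_profileMap_sub_le_of_le_of_le (hs : 0 ≤ s) (ht : 0 ≤ t) (hsm : s ≤ m) (htm : t ≤ m) :
    |profileMap m s - profileMap m t| ≤
      3 * |s - t| * min (s + t) (|s - m| + |t - m|) := by
  rcases (hs.trans hsm).eq_or_lt with rfl | hm
  · simp [le_antisymm hsm hs, le_antisymm htm ht]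
  set q := (3 * (s + t) * m - 2 * (s ^ 2 + s * t + t ^ 2)) / m with hq
  have hfactor : profileMap m s - profileMap m t = (s - t) * q := by
    rw [profileMap_of_le hsm, profileMap_of_le htm, hq]
    field_simp
    ring
  have hss := mul_nonneg hs (sub_nonneg.2 hsm)
  have htt := mul_nonneg ht (sub_nonneg.2 htm)
  have hst := mul_nonneg hs (sub_nonneg.2 htm)
  have hts := mul_nonneg ht (sub_nonneg.2 hsm)
  have hq₀ : 0 ≤ q := div_nonneg (by nlinarith) hm.le
  have hq₁ : q ≤ 3 * (s + t) := by
    rw [hq, div_le_iff₀ hm]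
    nlinarith [mul_nonneg hs ht]
  have hq₂ : q ≤ 3 * (|s - m| + |t - m|) := by
    rw [abs_of_nonpos (sub_nonpos.2 hsm), abs_of_nonpos (sub_nonpos.2 htm), hq, div_le_iff₀ hm]
    nlinarith [mul_nonneg (sub_nonneg.2 hsm) (sub_nonneg.2 htm), sq_nonneg (m - s),
      sq_nonneg (m - t)]
  rw [hfactor, abs_mul, abs_of_nonneg hq₀, mul_comm 3, mul_assoc]
  gcongr
  rw [mul_min_of_nonneg _ _ zero_le_three]
  exact le_min hq₁ hq₂

theorem abs_profileMap_sub_le_of_ge_of_ge (hm : 0 ≤ m) (hsm : m ≤ s) (htm : m ≤ t) :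
    |profileMap m s - profileMap m t| ≤
      3 * |s - t| * min (s + t) (|s - m| + |t - m|) := by
  have hfactor : profileMap m s - profileMap m t = (s - t) * ((s - m) + (t - m)) := by
    rw [profileMap_of_ge hm hsm, profileMap_of_ge hm htm]
    ring
  have hs := sub_nonneg.2 hsm
  have ht := sub_nonneg.2 htm
  rw [hfactor, abs_mul, abs_of_nonneg (add_nonneg hs ht), abs_of_nonneg hs, abs_of_nonneg ht,
    mul_comm 3, mul_assoc, min_eq_right (by linarith)]
  gcongr
  linarith

theorem abs_profileMap_sub_le_of_le_of_ge (hs : 0 ≤ s) (hsm : s ≤ m) (htm : m ≤ t) :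
    |profileMap m s - profileMap m t| ≤
      3 * |s - t| * min (s + t) (|s - m| + |t - m|) := by
  have hlow := sq_sub_le_profileMap hs hsm
  have hupp := profileMap_le_sq_sub hs hsm
  have hgap : s - t = -((t - m) + (m - s)) := by ring
  have hs' := sub_nonneg.2 hsm
  have ht' := sub_nonneg.2 htm
  rw [abs_sub_comm, profileMap_of_ge (hs.trans hsm) htm, hgap, abs_neg,
    abs_of_nonneg (add_nonneg ht' hs'), abs_of_nonpos (sub_nonpos.2 hsm), abs_of_nonneg ht',
    min_eq_right (by linarith), abs_of_nonneg (by nlinarith)]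
  nlinarith [mul_nonneg hs' ht', sq_nonneg (t - m)]

theorem abs_profileMap_sub_le (hm : 0 ≤ m) (hs : 0 ≤ s) (ht : 0 ≤ t) :
    |profileMap m s - profileMap m t| ≤
      3 * |s - t| * min (s + t) (|s - m| + |t - m|) := by
  rcases le_total s m with hsm | hsm <;> rcases le_total t m with htm | htm
  · exact abs_profileMap_sub_le_of_le_of_le hs ht hsm htm
  · exact abs_profileMap_sub_le_of_le_of_ge hs hsm htm
  · simpa only [abs_sub_comm, add_comm] using abs_profileMap_sub_le_of_le_of_ge ht htm hsm
  · exact abs_profileMap_sub_le_of_ge_of_ge hm hsm htm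

end ProfileMap

section Poincare

variable {H V : Type*} {X : Finset H} {g : H → ℝ} {m ε : ℝ}

/-- `m` is a median of `g` on `X`: at most half of the elements of `X` lie strictly on either side
of the level `m`. -/
def IsMedianOn (X : Finset H) (g : H → ℝ) (m : ℝ) : Prop :=
  2 * (X.filter fun h => g h < m).card ≤ X.card ∧ 2 * (X.filter fun h => m < g h).card ≤ X.card

theorem exists_isMedianOn (hX : X.Nonempty) (g : H → ℝ) : ∃ x ∈ X, IsMedianOn X g (g x) := by
  obtain ⟨y, hy, hmin⟩ := X.exists_min_image g hX
  have hlow : (X.filter fun x => 2 * (X.filter fun h => g h < g x).card ≤ X.card).Nonempty := by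
    refine ⟨y, Finset.mem_filter.2 ⟨hy, ?_⟩⟩
    rw [Finset.filter_false_of_mem fun h hh => not_lt.2 (hmin h hh)]
    simp
  obtain ⟨x, hx, hmax⟩ := Finset.exists_max_image _ g hlow
  rw [Finset.mem_filter] at hx
  refine ⟨x, hx.1, hx.2, ?_⟩
  rcases (X.filter fun h => g x < g h).eq_empty_or_nonempty with hE | hE
  · simp [hE]
  · obtain ⟨z, hz, hzmin⟩ := Finset.exists_min_image _ g hE
    rw [Finset.mem_filter] at hz
    have hzlow : ¬2 * (X.filter fun h => g h < g z).card ≤ X.card := fun hc =>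
      (hmax z (Finset.mem_filter.2 ⟨hz.1, hc⟩)).not_gt hz.2
    have hle : (X.filter fun h => g h < g z).card ≤ (X.filter fun h => ¬g x < g h).card :=
      Finset.card_le_card <| Finset.monotone_filter_right _ fun h hh hlt hxh =>
        (hzmin h (Finset.mem_filter.2 ⟨hh, hxh⟩)).not_gt hlt
    have := X.card_filter_add_card_filter_not (fun h => g x < g h)
    omega

theorem half_sum_sq_sub_le [Fintype H] (hm : 0 ≤ m) (hg : 0 ≤ g) {r : H → ℝ}
    (hr : ∀ h, r h = 0 ∨ r h = m) :
    (∑ h, (g h - r h) ^ 2) / 2 ≤ ∑ h, |profileMap m (g h) - r h ^ 2| := by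
  rw [Finset.sum_div]
  refine Finset.sum_le_sum fun h _ => ?_
  rcases hr h with hr | hr <;> rw [hr]
  · simpa using (half_sq_le_profileMap hm (hg h)).trans (le_abs_self _)
  · exact (half_le_self (sq_nonneg _)).trans (sq_sub_le_abs_profileMap_sub hm (hg h))

theorem abs_profileMap_sub_le_of_eq_or_eq {r s t : ℝ} (hm : 0 ≤ m) (hs : 0 ≤ s) (ht : 0 ≤ t)
    (hr : r = 0 ∨ r = m) :
    |profileMap m s - profileMap m t| ≤ 3 * |s - t| * (2 * |s - r| + |s - t|) := by
  refine (abs_profileMap_sub_le hm hs ht).trans ?_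
  gcongr
  rcases hr with rfl | rfl
  · refine (min_le_left _ _).trans ?_
    rw [sub_zero, abs_of_nonneg hs]
    linarith [neg_abs_le (s - t)]
  · refine (min_le_right _ _).trans ?_
    linarith [abs_sub_le t s r, abs_sub_comm s t]

theorem sum_abs_profileMap_sub_le [Fintype H] (σ : H → H) (hε : 0 < ε) (hm : 0 ≤ m) (hg : 0 ≤ g)
    {r : H → ℝ} (hr : ∀ h, r h = 0 ∨ r h = m) :
    ∑ h, |profileMap m (g h) - profileMap m (g (σ h))| ≤
      ε / 4 * ∑ h, (g h - r h) ^ 2 + (36 / ε + 3) * ∑ h, (g h - g (σ h)) ^ 2 := by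
  rw [Finset.mul_sum, Finset.mul_sum, ← Finset.sum_add_distrib]
  refine Finset.sum_le_sum fun h _ => ?_
  refine (abs_profileMap_sub_le_of_eq_or_eq hm (hg h) (hg (σ h)) (hr h)).trans ?_
  rw [← sq_abs (g h - r h), ← sq_abs (g h - g (σ h))]
  set x := |g h - r h|
  set y := |g h - g (σ h)|
  have hamgm : ε / 4 * x ^ 2 + 36 / ε * y ^ 2 - 6 * x * y = (ε * x - 12 * y) ^ 2 / (4 * ε) := by
    field_simp
    ring
  have : 0 ≤ (ε * x - 12 * y) ^ 2 / (4 * ε) := by positivity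
  linarith

variable [Fintype H] {v : H → V} {σ : H → H} {p : ℕ} {f : V → ℝ}

variable [DecidableEq V]

/-- The half-edges attached to the vertices of `A`. -/
def halfEdges (v : H → V) (A : Finset V) : Finset H := {h | v h ∈ A}

theorem mem_halfEdges {A : Finset V} {h : H} : h ∈ halfEdges v A ↔ v h ∈ A := by simp [halfEdges]

variable [DecidableEq H]

/-- `S` fills at most half of `X` and at most half of the complement of `X`. -/
def SmallInHalves (X S : Finset H) : Prop :=
  2 * (S ∩ X).card ≤ X.card ∧ 2 * (S ∩ Xᶜ).card ≤ Xᶜ.card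

theorem SmallInHalves.compl {S : Finset H} (h : SmallInHalves Xᶜ S) : SmallInHalves X S := by
  simpa only [SmallInHalves, compl_compl, and_comm] using h

/-- Edge expansion of `σ` relative to a splitting of the half-edges into `X` and `Xᶜ`, joined by
about `p` edges: a vertex set which is small in both halves has a boundary of proportional size, and
so does one which is close to the half `X`, whose boundary must moreover be of order `p`. -/
structure ExpandsAcross (σ : H → H) (v : H → V) (X : Finset H) (p : ℕ) (ε : ℝ) : Prop where
  aligned : ∀ A, SmallInHalves X (halfEdges v A) →
    ε * (halfEdges v A).card ≤ (edgeBoundary σ (halfEdges v A)).card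
  twisted : ∀ A, SmallInHalves X (halfEdges v A ∆ X) →
    ε * (p + (halfEdges v A ∆ X).card) ≤ (edgeBoundary σ (halfEdges v A)).card

theorem halfEdges_compl [Fintype V] (A : Finset V) : halfEdges v Aᶜ = (halfEdges v A)ᶜ := by
  ext
  simp [mem_halfEdges]

variable [Finite V]

theorem ExpandsAcross.compl (hσ : ExpandsAcross σ v X p ε) : ExpandsAcross σ v Xᶜ p ε where
  aligned A hA := hσ.aligned A hA.compl
  twisted A hA := by
    have := Fintype.ofFinite V
    have hcompl : halfEdges v A ∆ Xᶜ = halfEdges v Aᶜ ∆ X := by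
      rw [halfEdges_compl]
      ext
      simp only [Finset.mem_symmDiff, Finset.mem_compl]
      tauto
    rw [hcompl] at hA ⊢
    simpa only [halfEdges_compl, edgeBoundary_compl] using hσ.twisted Aᶜ hA.compl

theorem ExpandsAcross.mul_levelDist_le (hσ : ExpandsAcross σ v X p ε) (hf : 0 ≤ f) (hm : 0 ≤ m)
    (hmed : IsMedianOn X (f ∘ v) m)
    (hsupp : 2 * (Xᶜ.filter fun h => f (v h) ≠ 0).card ≤ Xᶜ.card) {t : ℝ} (ht : 0 ≤ t) :
    ε * levelDist (Sum.elim (fun _ : Fin p => m ^ 2) fun h => profileMap m (f (v h)))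
        (Sum.elim 0 fun h => if h ∈ X then m ^ 2 else 0) t ≤
      levelDist (fun h => profileMap m (f (v h))) (fun h => profileMap m (f (v (σ h)))) t := by
  have := Fintype.ofFinite V
  set A : Finset V := {x | t < profileMap m (f x)} with hA
  have hS : halfEdges v A = Finset.univ.filter fun h => t < profileMap m (f (v h)) := by
    ext h
    simp [mem_halfEdges, hA]
  have hmem : ∀ h, h ∈ halfEdges v A ↔ t < profileMap m (f (v h)) := by simp [hS]
  have hright : levelDist (fun h => profileMap m (f (v h)))
      (fun h => profileMap m (f (v (σ h)))) t = (edgeBoundary σ (halfEdges v A)).card := by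
    simp only [levelDist, edgeBoundary, hmem]
  have hsmall : ∀ S, S ∩ Xᶜ ⊆ halfEdges v A → 2 * (S ∩ Xᶜ).card ≤ Xᶜ.card := fun S hS => by
    refine (Nat.mul_le_mul_left 2 (Finset.card_le_card fun h hh => ?_)).trans hsupp
    refine Finset.mem_filter.2 ⟨Finset.mem_of_mem_inter_right hh, fun h0 => ?_⟩
    have := (hmem h).1 (hS hh)
    rw [h0, profileMap_zero hm] at this
    exact ht.not_gt this
  rw [levelDist_sumElim, hright, levelDist_const_zero _ ht]
  rcases lt_or_ge t (m ^ 2) with htm | htm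
  · have hdist := levelDist_ite_of_lt (fun h => profileMap m (f (v h))) X ht htm
    have hhalf : 2 * ((halfEdges v A ∆ X) ∩ X).card ≤ X.card := by
      refine (Nat.mul_le_mul_left 2 (Finset.card_le_card fun h hh => ?_)).trans hmed.1
      obtain ⟨hhS, hhX⟩ := Finset.mem_inter.1 hh
      refine Finset.mem_filter.2 ⟨hhX, (profileMap_lt_sq_iff hm (hf _)).1 (lt_of_le_of_lt ?_ htm)⟩
      simpa [Finset.mem_symmDiff, hhX, hmem] using hhS
    have htwist := hσ.twisted A ⟨hhalf, hsmall _ fun h hh => by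
      simp only [Finset.mem_inter, Finset.mem_symmDiff, Finset.mem_compl] at hh
      tauto⟩
    simpa [hdist, htm, hS] using htwist
  · have hdist := levelDist_ite_of_ge (fun h => profileMap m (f (v h))) X ht htm
    have hhalf : 2 * (halfEdges v A ∩ X).card ≤ X.card := by
      refine (Nat.mul_le_mul_left 2 (Finset.card_le_card fun h hh => ?_)).trans hmed.2
      obtain ⟨hhS, hhX⟩ := Finset.mem_inter.1 hh
      exact Finset.mem_filter.2
        ⟨hhX, (sq_lt_profileMap_iff hm (hf _)).1 (htm.trans_lt ((hmem h).1 hhS))⟩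
    have halign := hσ.aligned A ⟨hhalf, hsmall _ Finset.inter_subset_left⟩
    simpa [hdist, htm.not_gt, hS] using halign

theorem ExpandsAcross.le_sum_abs_profileMap_sub (hσ : ExpandsAcross σ v X p ε) (hf : 0 ≤ f)
    (hm : 0 ≤ m) (hmed : IsMedianOn X (f ∘ v) m)
    (hsupp : 2 * (Xᶜ.filter fun h => f (v h) ≠ 0).card ≤ Xᶜ.card) :
    ε * (p * m ^ 2 + ∑ h, |profileMap m (f (v h)) - if h ∈ X then m ^ 2 else 0|) ≤
      ∑ h, |profileMap m (f (v h)) - profileMap m (f (v (σ h)))| := by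
  have hΦ : ∀ x, 0 ≤ profileMap m (f x) := fun x => profileMap_nonneg hm (hf x)
  have h := mul_sum_abs_sub_le_of_levelDist (fun i => ?_) (fun i => ?_) (fun h => hΦ (v h))
    (fun h => hΦ (v (σ h))) fun t ht => hσ.mul_levelDist_le hf hm hmed hsupp ht
  · simpa [Fintype.sum_sum_type, abs_of_nonneg (sq_nonneg m)] using h
  · rcases i with _ | h
    exacts [sq_nonneg m, hΦ (v h)]
  · rcases i with _ | h
    · exact le_rfl
    · simp only [Sum.elim_inr, Pi.zero_apply]
      positivity

theorem ExpandsAcross.poincare (hσ : ExpandsAcross σ v X p ε) (hε : 0 < ε) (hε1 : ε ≤ 1)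
    (hX : X.Nonempty) (hp : p ≤ Fintype.card H) (hf : 0 ≤ f)
    (hsupp : 2 * (Xᶜ.filter fun h => f (v h) ≠ 0).card ≤ Xᶜ.card) :
    ε ^ 2 / 312 * (p / Fintype.card H) * ∑ h, f (v h) ^ 2 ≤
      ∑ h, (f (v h) - f (v (σ h))) ^ 2 := by
  obtain ⟨x, -, hmed⟩ := exists_isMedianOn hX (f ∘ v)
  set m := f (v x)
  have hm : 0 ≤ m := hf _
  have hg : 0 ≤ f ∘ v := fun h => hf _
  set r : H → ℝ := fun h => if h ∈ X then m else 0
  have hr : ∀ h, r h = 0 ∨ r h = m := fun h => (ite_eq_or_eq _ _ _).symm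
  have hr_sq : ∀ h, (if h ∈ X then m ^ 2 else 0) = r h ^ 2 := fun h => by simp [r]
  set E := ∑ h, (f (v h) - f (v (σ h))) ^ 2
  set D := ∑ h, (f (v h) - r h) ^ 2
  have hD : 0 ≤ D := Finset.sum_nonneg fun h _ => sq_nonneg _
  have hE : 0 ≤ E := Finset.sum_nonneg fun h _ => sq_nonneg _
  have hcard : (0 : ℝ) < Fintype.card H := Nat.cast_pos.2 (Fintype.card_pos_iff.2 ⟨x⟩)
  have hnorm : ∑ h, f (v h) ^ 2 ≤ 2 * D + 2 * (Fintype.card H * m ^ 2) := by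
    rw [← nsmul_eq_mul, ← Finset.card_univ, ← Finset.sum_const, Finset.mul_sum, Finset.mul_sum,
      ← Finset.sum_add_distrib]
    refine Finset.sum_le_sum fun h _ => ?_
    have : r h ^ 2 ≤ m ^ 2 := by rcases hr h with h0 | h0 <;> simp [h0, sq_nonneg]
    linarith [sq_nonneg (f (v h) - 2 * r h)]
  have hmain : (p : ℝ) / Fintype.card H * ∑ h, f (v h) ^ 2 ≤ 8 * (p * m ^ 2 + D / 4) := by
    have hq : (p : ℝ) / Fintype.card H ≤ 1 := (div_le_one hcard).2 (by exact_mod_cast hp)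
    calc (p : ℝ) / Fintype.card H * ∑ h, f (v h) ^ 2
        ≤ p / Fintype.card H * (2 * D + 2 * (Fintype.card H * m ^ 2)) := by gcongr
      _ = 2 * (p / Fintype.card H * D) + 2 * (p * m ^ 2) := by field_simp
      _ ≤ 2 * (1 * D) + 8 * (p * m ^ 2) := by gcongr; norm_num
      _ = 8 * (p * m ^ 2 + D / 4) := by ring
  have henergy : ε * (p * m ^ 2 + D / 4) ≤ (36 / ε + 3) * E := by
    have hcoarea := hσ.le_sum_abs_profileMap_sub hf hm hmed hsupp
    simp only [hr_sq] at hcoarea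
    have hlow := mul_le_mul_of_nonneg_left (half_sum_sq_sub_le hm hg hr) hε.le
    have hupp := sum_abs_profileMap_sub_le σ hε hm hg hr
    simp only [Function.comp_apply] at hlow hupp
    linarith
  calc ε ^ 2 / 312 * (p / Fintype.card H) * ∑ h, f (v h) ^ 2
      = ε ^ 2 / 312 * (p / Fintype.card H * ∑ h, f (v h) ^ 2) := mul_assoc _ _ _
    _ ≤ ε ^ 2 / 312 * (8 * (p * m ^ 2 + D / 4)) := by gcongr
    _ = ε / 39 * (ε * (p * m ^ 2 + D / 4)) := by ring
    _ ≤ ε / 39 * ((36 / ε + 3) * E) := by gcongr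
    _ = (36 + 3 * ε) / 39 * E := by field_simp
    _ ≤ 1 * E := by gcongr; linarith
    _ = E := one_mul E

end Poincare

section Dirichlet

variable {S : Type u} [Fintype S] [DecidableEq S] {P : Matrix S S ℝ} {A : Finset S}

theorem exists_dirichlet_eigenfunction {μ : ℝ} (hμ : Module.End.HasEigenvalue
      (Matrix.toLin' (P.submatrix (fun x : A => (x : S)) (fun x : A => (x : S)))) μ) :
    ∃ f : S → ℝ, f ≠ 0 ∧ (∀ x ∉ A, f x = 0) ∧ ∀ x ∈ A, ∑ y, P x y * f y = μ * f x := by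
  obtain ⟨g, hg⟩ := hμ.exists_hasEigenvector
  refine ⟨fun x => if h : x ∈ A then g ⟨x, h⟩ else 0, fun h0 => hg.2 (funext fun x => ?_),
    fun x hx => dif_neg hx, fun x hx => ?_⟩
  · simpa using congrFun h0 x.1
  · have hx' := congrFun hg.apply_eq_smul ⟨x, hx⟩
    simp only [Matrix.toLin'_apply, Matrix.mulVec, dotProduct, Matrix.submatrix_apply,
      Pi.smul_apply, smul_eq_mul] at hx'
    beta_reduce
    rw [dif_pos hx, ← hx', ← Finset.sum_subset (Finset.subset_univ A) fun y _ hy => by simp [hy],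
      ← Finset.sum_coe_sort A]
    simp

theorem le_dirichletEigenvalue {w : S → ℝ} (hw : ∀ x, 0 < w x) {c : ℝ} (hc : c ≤ 1)
    (h : ∀ f : S → ℝ, (∀ x ∉ A, f x = 0) →
      ∑ x, w x * (f x * ∑ y, P x y * f y) ≤ (1 - c) * ∑ x, w x * f x ^ 2) :
    c ≤ dirichletEigenvalue P A := by
  rw [dirichletEigenvalue, le_sub_comm]
  refine Real.sSup_le (fun μ hμ => ?_) (sub_nonneg.2 hc)
  obtain ⟨f, hf0, hfA, hf⟩ := exists_dirichlet_eigenfunction hμ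
  have hμf : ∑ x, w x * (f x * ∑ y, P x y * f y) = μ * ∑ x, w x * f x ^ 2 := by
    rw [Finset.mul_sum]
    refine Finset.sum_congr rfl fun x _ => ?_
    by_cases hx : x ∈ A
    · rw [hf x hx]
      ring
    · simp [hfA x hx]
  have hpos : 0 < ∑ x, w x * f x ^ 2 := by
    obtain ⟨x, hx⟩ := Function.ne_iff.1 hf0
    exact Finset.sum_pos' (fun y _ => mul_nonneg (hw y).le (sq_nonneg _))
      ⟨x, Finset.mem_univ x, mul_pos (hw x) (sq_pos_of_ne_zero hx)⟩
  exact le_of_mul_le_mul_right (hμf ▸ h f hfA) hpos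

end Dirichlet

namespace TwoCommunities

section LazyWalk

variable {M : TwoCommunities.{u}} {σ : M.H → M.H}

theorem card_H₁ : Fintype.card M.H₁ = M.N₁ := by simp [N₁]

theorem card_H₂ : Fintype.card M.H₂ = M.N₂ := by simp [N₂]

theorem card_H : Fintype.card M.H = M.N := by
  rw [Fintype.card_sum, card_H₁, card_H₂, N]

theorem N₁_pos : 0 < M.N₁ := two_pos.trans_le (M.two_le_p.trans M.p_le_N₁)

theorem N₂_pos : 0 < M.N₂ := two_pos.trans_le (M.two_le_p.trans M.p_le_N₂)

theorem N_pos : 0 < M.N := Nat.add_pos_left N₁_pos _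

theorem two_le_d (x : M.V) : 2 ≤ M.d x :=
  x.casesOn M.two_le_d₁ M.two_le_d₂

theorem d_pos (x : M.V) : (0 : ℝ) < M.d x :=
  Nat.cast_pos.2 (two_pos.trans_le (two_le_d x))

theorem sum_vertex {R : Type*} [NonAssocSemiring R] (F : M.V → R) :
    ∑ h : M.H, F (M.vertex h) = ∑ x, M.d x * F x := by
  simp [Fintype.sum_sum_type, Fintype.sum_sigma, vertex, d]

theorem sum_d : ∑ x, M.d x = M.N := by
  simp [Fintype.sum_sum_type, d, N, N₁, N₂]

theorem card_halfEdges (A : Finset M.V) : (halfEdges M.vertex A).card = ∑ x ∈ A, M.d x := by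
  have h := sum_vertex (M := M) fun x => if x ∈ A then (1 : ℕ) else 0
  rw [halfEdges, Finset.card_filter]
  simpa only [mul_ite, mul_one, mul_zero, Finset.sum_ite_mem, Finset.univ_inter, Nat.cast_id]
    using h

theorem n_le_N : M.n ≤ M.N := by
  rw [← sum_d, n, Fintype.card_eq_sum_ones]
  exact Finset.sum_le_sum fun x _ => one_le_two.trans (two_le_d x)

theorem d_mul_sum_lazyWalk_mul (σ : M.H → M.H) (f : M.V → ℝ) (x : M.V) :
    M.d x * ∑ y, lazyWalk σ x y * f y =
      (M.d x * f x + ∑ h with M.vertex h = x, f (M.vertex (σ h))) / 2 := by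
  have hsplit : ∀ y, M.d x * (lazyWalk σ x y * f y) = (if x = y then M.d x * f y / 2 else 0) +
      ∑ h with M.vertex h = x, if M.vertex (σ h) = y then f y / 2 else 0 := fun y => by
    rw [← Finset.sum_filter, Finset.filter_filter, Finset.sum_const, nsmul_eq_mul, lazyWalk]
    have := (d_pos x).ne'
    split_ifs
    · field_simp
    · field_simp
      ring
  rw [Finset.mul_sum]
  simp only [hsplit, Finset.sum_add_distrib]
  rw [Finset.sum_comm, add_div, Finset.sum_div]
  simp

theorem sum_d_mul_lazyWalk (hσ : Function.Bijective σ) (f : M.V → ℝ) :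
    ∑ x, M.d x * (f x * ∑ y, lazyWalk σ x y * f y) =
      ∑ x, M.d x * f x ^ 2 - (∑ h, (f (M.vertex h) - f (M.vertex (σ h))) ^ 2) / 4 := by
  have hprod : ∑ x, f x * ∑ h with M.vertex h = x, f (M.vertex (σ h)) =
      ∑ h, f (M.vertex h) * f (M.vertex (σ h)) := by
    rw [← Finset.sum_fiberwise Finset.univ M.vertex]
    refine Finset.sum_congr rfl fun x _ => ?_
    rw [Finset.mul_sum]
    refine Finset.sum_congr rfl fun h hh => ?_
    rw [(Finset.mem_filter.1 hh).2]
  have henergy : ∑ h, (f (M.vertex h) - f (M.vertex (σ h))) ^ 2 =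
      2 * ∑ x, M.d x * f x ^ 2 - 2 * ∑ h, f (M.vertex h) * f (M.vertex (σ h)) := by
    rw [← sum_vertex fun x => f x ^ 2]
    have hσ_sum := hσ.sum_comp fun h => f (M.vertex h) ^ 2
    simp only [sub_sq, Finset.sum_add_distrib, Finset.sum_sub_distrib, mul_assoc,
      ← Finset.mul_sum, hσ_sum]
    ring
  have hx : ∀ x, M.d x * (f x * ∑ y, lazyWalk σ x y * f y) =
      M.d x * f x ^ 2 / 2 + (f x * ∑ h with M.vertex h = x, f (M.vertex (σ h))) / 2 := fun x => by
    rw [mul_left_comm, d_mul_sum_lazyWalk_mul]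
    ring
  simp only [hx, Finset.sum_add_distrib, ← Finset.sum_div, hprod, henergy]
  ring

theorem exists_stationary_le_half (hn : 2 ≤ M.n) :
    ∃ x : M.V, (⨅ y, M.stationary y) ≤ M.stationary x ∧ M.stationary x ≤ 1 / 2 := by
  have : Nonempty M.V := Fintype.card_pos_iff.1 (two_pos.trans_le hn)
  obtain ⟨x, hx⟩ := Finite.exists_min M.d
  refine ⟨x, ciInf_le (Set.finite_range _).bddBelow x, ?_⟩
  have hdN : 2 * M.d x ≤ M.N := by
    refine (Nat.mul_le_mul_right _ hn).trans ?_
    rw [← sum_d, n, ← smul_eq_mul, ← Finset.card_univ]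
    exact Finset.card_nsmul_le_sum _ _ _ fun y _ => hx y
  rw [stationary, div_le_div_iff₀ (Nat.cast_pos.2 N_pos) two_pos]
  exact_mod_cast (by omega : M.d x * 2 ≤ 1 * M.N)

theorem sum_stationary_le_half_iff (A : Finset M.V) :
    ∑ x ∈ A, M.stationary x ≤ 1 / 2 ↔ 2 * (halfEdges M.vertex A).card ≤ M.N := by
  simp only [stationary, ← Finset.sum_div, card_halfEdges]
  rw [div_le_div_iff₀ (Nat.cast_pos.2 N_pos) two_pos, one_mul, mul_comm]
  exact_mod_cast Iff.rfl

theorem le_spectralProfile_of_poincare (hσ : Function.Bijective σ) (hn : 2 ≤ M.n) {c : ℝ}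
    (hc : c ≤ 1)
    (hpoincare : ∀ f : M.V → ℝ, 0 ≤ f →
      2 * (Finset.univ.filter fun h => f (M.vertex h) ≠ 0).card ≤ M.N →
      4 * c * ∑ h, f (M.vertex h) ^ 2 ≤ ∑ h, (f (M.vertex h) - f (M.vertex (σ h))) ^ 2) :
    c ≤ spectralProfile (lazyWalk σ) M.stationary (1 / 2) := by
  refine le_csInf ?_ ?_
  · obtain ⟨x, hx⟩ := exists_stationary_le_half hn
    exact ⟨_, {x}, by simpa using hx, rfl⟩
  rintro _ ⟨A, ⟨-, hA⟩, rfl⟩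
  refine le_dirichletEigenvalue d_pos hc fun f hf => ?_
  have habs : ∑ h, (|f (M.vertex h)| - |f (M.vertex (σ h))|) ^ 2 ≤
      ∑ h, (f (M.vertex h) - f (M.vertex (σ h))) ^ 2 :=
    Finset.sum_le_sum fun h _ => sq_le_sq.2 (abs_abs_sub_abs_le _ _)
  have hsupp : 2 * (Finset.univ.filter fun h => |f (M.vertex h)| ≠ 0).card ≤ M.N := by
    refine le_trans (Nat.mul_le_mul_left 2 (Finset.card_le_card fun h hh => ?_))
      ((sum_stationary_le_half_iff A).1 hA)
    rw [Finset.mem_filter_univ, abs_ne_zero] at hh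
    exact mem_halfEdges.2 (by_contra fun hc => hh (hf _ hc))
  have h := (hpoincare (fun x => |f x|) (fun x => abs_nonneg _) hsupp).trans habs
  simp only [sq_abs, sum_vertex fun x => f x ^ 2] at h
  rw [sum_d_mul_lazyWalk hσ]
  linarith

end LazyWalk

end TwoCommunities

section Entropy

/-- `exp (N H(s / N))`, where `H` is the binary entropy; it agrees with the binomial coefficient
`N.choose s` up to a factor linear in `s`. -/
def entropyFactor (N s : ℕ) : ℝ :=
  (N : ℝ) ^ N / ((s : ℝ) ^ s * ((N - s : ℕ) : ℝ) ^ (N - s))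

theorem cast_pow_self_pos (k : ℕ) : (0 : ℝ) < (k : ℝ) ^ k :=
  mod_cast Nat.pow_self_pos

theorem entropyFactor_pos (N s : ℕ) : 0 < entropyFactor N s :=
  div_pos (cast_pow_self_pos N) (mul_pos (cast_pow_self_pos s) (cast_pow_self_pos (N - s)))

theorem entropyFactor_zero (N : ℕ) : entropyFactor N 0 = 1 := by
  simp [entropyFactor, (cast_pow_self_pos N).ne']

theorem entropyFactor_mul_pow {N s : ℕ} (h : s < N) :
    entropyFactor N s * ((s : ℝ) / (N - s)) ^ s = (1 + (s : ℝ) / (N - s)) ^ N := by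
  have hNs : (0 : ℝ) < N - s := sub_pos.2 (mod_cast h)
  have hbase : 1 + (s : ℝ) / (N - s) = N / (N - s) := by field_simp; ring
  have hsplit : ((N : ℝ) - s) ^ N = (N - s) ^ (N - s) * (N - s) ^ s := by
    rw [← pow_add, Nat.sub_add_cancel h.le]
  have hs := (cast_pow_self_pos s).ne'
  rw [hbase, entropyFactor, Nat.cast_sub h.le, div_pow, div_pow, hsplit]
  field_simp

theorem div_pow_le_entropyFactor {N s : ℕ} (h : s ≤ N) :
    ((N : ℝ) / s) ^ s ≤ entropyFactor N s := by
  have hsplit : (N : ℝ) ^ N = N ^ s * N ^ (N - s) := by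
    rw [← pow_add, Nat.add_sub_cancel' h]
  have hs := cast_pow_self_pos s
  rw [entropyFactor, div_pow, hsplit, div_le_div_iff₀ hs (mul_pos hs (cast_pow_self_pos _))]
  calc (N : ℝ) ^ s * ((s : ℝ) ^ s * ((N - s : ℕ) : ℝ) ^ (N - s))
      ≤ (N : ℝ) ^ s * ((s : ℝ) ^ s * (N : ℝ) ^ (N - s)) := by gcongr; exact Nat.sub_le _ _
    _ = _ := by ring

/-- The leading term `s log (N / s)` of the entropy of the subsets of size `s` of a set of size `N`;
it vanishes at `s = 0`. -/
def selectionCost (N s : ℕ) : ℝ := s * Real.log (N / s)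

theorem mul_log_le_selectionCost {N s : ℕ} {q : ℝ} (hq : 0 < q) (h : q * s ≤ N) :
    s * Real.log q ≤ selectionCost N s := by
  rcases Nat.eq_zero_or_pos s with rfl | h0
  · simp [selectionCost]
  · have hs : (0 : ℝ) < s := mod_cast h0
    exact mul_le_mul_of_nonneg_left (Real.log_le_log hq ((le_div_iff₀ hs).2 h)) hs.le

theorem exp_selectionCost_mul_le {N s : ℕ} (h : s ≤ N) {c : ℝ} (hc : 0 ≤ c) :
    Real.exp (selectionCost N s * c) ≤ entropyFactor N s ^ c := by
  rw [Real.exp_mul]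
  refine Real.rpow_le_rpow (Real.exp_pos _).le ?_ hc
  refine le_trans (le_of_eq ?_) (div_pow_le_entropyFactor h)
  rcases Nat.eq_zero_or_pos s with rfl | h0
  · simp [selectionCost]
  · have hs : (0 : ℝ) < s := mod_cast h0
    have hN : (0 : ℝ) < N := mod_cast h0.trans_le h
    rw [selectionCost, Real.exp_nat_mul, Real.exp_log (by positivity)]

theorem succ_pow_le_exp_mul (k : ℕ) : ((k : ℝ) + 1) ^ k ≤ Real.exp 1 * (k : ℝ) ^ k := by
  rcases Nat.eq_zero_or_pos k with rfl | h
  · simp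
  have hk : (0 : ℝ) < k := mod_cast h
  have hone : (1 / (k : ℝ) + 1) ^ k ≤ Real.exp 1 :=
    calc (1 / (k : ℝ) + 1) ^ k ≤ (Real.exp (1 / k)) ^ k := by
          gcongr; exact Real.add_one_le_exp _
      _ = Real.exp 1 := by rw [← Real.exp_nat_mul]; congr 1; field_simp
  calc ((k : ℝ) + 1) ^ k = (1 / (k : ℝ) + 1) ^ k * (k : ℝ) ^ k := by
        rw [← mul_pow]; congr 1; field_simp; ring
    _ ≤ _ := by gcongr

theorem exp_mul_pow_succ_le (k : ℕ) :
    Real.exp 1 * (k : ℝ) ^ (k + 1) ≤ ((k : ℝ) + 1) ^ (k + 1) := by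
  have hone : (k / ((k : ℝ) + 1)) ^ (k + 1) ≤ Real.exp (-1) :=
    calc (k / ((k : ℝ) + 1)) ^ (k + 1) = (-(1 / ((k : ℝ) + 1)) + 1) ^ (k + 1) := by
          congr 1; field_simp; ring
      _ ≤ Real.exp (-(1 / ((k : ℝ) + 1))) ^ (k + 1) := by
          refine pow_le_pow_left₀ ?_ (Real.add_one_le_exp _) _
          rw [neg_add_eq_sub, sub_nonneg, div_le_one (by positivity)]
          exact le_add_of_nonneg_left (Nat.cast_nonneg k)
      _ = Real.exp (-1) := by rw [← Real.exp_nat_mul]; congr 1; push_cast; field_simp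
  rw [div_pow, div_le_iff₀ (by positivity), Real.exp_neg] at hone
  calc Real.exp 1 * (k : ℝ) ^ (k + 1)
      ≤ Real.exp 1 * ((Real.exp 1)⁻¹ * ((k : ℝ) + 1) ^ (k + 1)) := by gcongr
    _ = _ := mul_inv_cancel_left₀ (Real.exp_ne_zero 1) _

theorem pow_self_le_mul_choose {N s : ℕ} (hs : 1 ≤ s) (h : s ≤ N) :
    (N : ℝ) ^ N ≤
      Real.exp 1 * s * N.choose s * ((s : ℝ) ^ s * ((N - s : ℕ) : ℝ) ^ (N - s)) := by
  induction s, hs using Nat.le_induction with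
  | base =>
    obtain ⟨k, rfl⟩ : ∃ k, N = k + 1 := ⟨N - 1, by omega⟩
    simp only [Nat.cast_one, Nat.choose_one_right, Nat.add_sub_cancel, one_pow, one_mul, mul_one]
    push_cast
    rw [pow_succ]
    nlinarith [succ_pow_le_exp_mul k, k.cast_nonneg (α := ℝ)]
  | succ s hs ih =>
    refine (ih (by omega)).trans ?_
    obtain ⟨k, rfl⟩ : ∃ k, N = s + (k + 1) := ⟨N - s - 1, by omega⟩
    have hchoose : ((s + (k + 1)).choose (s + 1) : ℝ) * (s + 1) =
        (s + (k + 1)).choose s * (k + 1) := by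
      have := Nat.choose_succ_right_eq (s + (k + 1)) s
      rw [Nat.add_sub_cancel_left] at this
      exact_mod_cast this
    have hpow : (s : ℝ) ^ (s + 1) * ((k : ℝ) + 1) ^ k ≤ ((s : ℝ) + 1) ^ (s + 1) * (k : ℝ) ^ k :=
      calc (s : ℝ) ^ (s + 1) * ((k : ℝ) + 1) ^ k
          ≤ (s : ℝ) ^ (s + 1) * (Real.exp 1 * (k : ℝ) ^ k) := by
            gcongr; exact succ_pow_le_exp_mul k
        _ = (Real.exp 1 * (s : ℝ) ^ (s + 1)) * (k : ℝ) ^ k := by ring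
        _ ≤ _ := by gcongr; exact exp_mul_pow_succ_le s
    rw [Nat.add_sub_cancel_left, show s + (k + 1) - (s + 1) = k by omega]
    push_cast
    calc _ = Real.exp 1 * ((s + (k + 1)).choose s * (k + 1)) *
          ((s : ℝ) ^ (s + 1) * ((k : ℝ) + 1) ^ k) := by ring
      _ ≤ Real.exp 1 * ((s + (k + 1)).choose s * (k + 1)) *
          (((s : ℝ) + 1) ^ (s + 1) * (k : ℝ) ^ k) := by gcongr
      _ = _ := by rw [← hchoose]; ring

theorem entropyFactor_le_mul_choose {N s : ℕ} (h : s ≤ N) :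
    entropyFactor N s ≤ (3 * s + 1) * N.choose s := by
  rcases Nat.eq_zero_or_pos s with rfl | h0
  · simp [entropyFactor_zero]
  rw [entropyFactor, div_le_iff₀ (mul_pos (cast_pow_self_pos s) (cast_pow_self_pos _))]
  refine (pow_self_le_mul_choose h0 h).trans ?_
  gcongr
  nlinarith [Real.exp_one_lt_three, s.cast_nonneg (α := ℝ)]

theorem sqrt_entropyFactor_le {N s : ℕ} (h : s ≤ N) :
    √(entropyFactor N s) ≤
      (3 * s + 1) * entropyFactor N s ^ (-(1 / 2) : ℝ) * N.choose s := by
  have hpos := entropyFactor_pos N s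
  calc √(entropyFactor N s) = entropyFactor N s * entropyFactor N s ^ (-(1 / 2) : ℝ) := by
        rw [Real.sqrt_eq_rpow, ← Real.rpow_one_add' hpos.le (by norm_num)]
        norm_num
    _ ≤ (3 * s + 1) * N.choose s * entropyFactor N s ^ (-(1 / 2) : ℝ) := by
        gcongr; exact entropyFactor_le_mul_choose h
    _ = _ := by ring

/-- The square root of the odds `s : N - s`. As the weight of an element of a random subset of a set
of size `N`, it balances the entropy of the subsets of size `s`. -/
def sqrtOdds (N s : ℕ) : ℝ := √((s : ℝ) / (N - s))

theorem sqrtOdds_nonneg (N s : ℕ) : 0 ≤ sqrtOdds N s := Real.sqrt_nonneg _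

theorem sqrtOdds_pow_pos {N s : ℕ} (h : s < N) : 0 < sqrtOdds N s ^ s := by
  rcases Nat.eq_zero_or_pos s with rfl | h0
  · simp
  · have hNs : (0 : ℝ) < N - s := sub_pos.2 (mod_cast h)
    have hs : (0 : ℝ) < s := mod_cast h0
    exact pow_pos (Real.sqrt_pos.2 (by positivity)) s

theorem sqrt_entropyFactor_mul_pow {N s : ℕ} (h : s < N) :
    √(entropyFactor N s) * sqrtOdds N s ^ s = √(1 + sqrtOdds N s ^ 2) ^ N := by
  have hNs : (0 : ℝ) < N - s := sub_pos.2 (mod_cast h)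
  have hodds : 0 ≤ (s : ℝ) / (N - s) := by positivity
  have sqrt_pow {a : ℝ} (ha : 0 ≤ a) (k : ℕ) : √a ^ k = √(a ^ k) := by
    simp only [Real.sqrt_eq_rpow, ← Real.rpow_natCast, ← Real.rpow_mul ha, mul_comm]
  rw [sqrtOdds, Real.sq_sqrt hodds, sqrt_pow hodds, sqrt_pow (by positivity),
    ← Real.sqrt_mul (entropyFactor_pos _ _).le, entropyFactor_mul_pow h]

end Entropy

section Volume

theorem one_add_pow_le_rpow {u : ℝ} (hu : 0 ≤ u) {d : ℕ} (hd : 3 ≤ d) :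
    1 + u ^ d ≤ (1 + u ^ 3) ^ ((d : ℝ) / 3) := by
  lift u to NNReal using hu
  have hd0 : (0 : ℝ) < d := by exact_mod_cast (by omega : 0 < d)
  have hnorm : (1 + (u : ℝ) ^ d) ^ (1 / (d : ℝ)) ≤ (1 + (u : ℝ) ^ 3) ^ (1 / 3 : ℝ) := by
    have h := NNReal.rpow_add_rpow_le (p := (3 : ℕ)) (q := d) 1 u (by norm_num) (mod_cast hd)
    simp only [NNReal.rpow_natCast, one_pow] at h
    exact_mod_cast NNReal.coe_le_coe.2 h
  have := Real.rpow_le_rpow (by positivity) hnorm hd0.le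
  rwa [← Real.rpow_mul (by positivity), ← Real.rpow_mul (by positivity),
    one_div_mul_cancel hd0.ne', Real.rpow_one, one_div_mul_eq_div] at this

variable {V : Type*} [Fintype V] {d : V → ℕ} {s : ℕ}

theorem sum_pow_volume_le (hd : ∀ v, 3 ≤ d v) {u : ℝ} (hu : 0 ≤ u) :
    ∑ B : Finset V, u ^ (∑ v ∈ B, d v) ≤ ((1 + u ^ 3) ^ ∑ v, d v) ^ (1 / 3 : ℝ) := by
  classical
  calc ∑ B : Finset V, u ^ (∑ v ∈ B, d v) = ∏ v, (1 + u ^ d v) := by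
        rw [Finset.prod_one_add, Finset.powerset_univ]
        exact Finset.sum_congr rfl fun B _ => (Finset.prod_pow_eq_pow_sum _ _ _).symm
    _ ≤ ∏ v, (1 + u ^ 3) ^ ((d v : ℝ) / 3) :=
        Finset.prod_le_prod (fun v _ => by positivity) fun v _ => one_add_pow_le_rpow hu (hd v)
    _ = _ := by
        rw [← Real.rpow_sum_of_pos (by positivity), ← Finset.sum_div, ← Nat.cast_sum,
          ← Real.rpow_natCast (1 + u ^ 3), ← Real.rpow_mul (by positivity), mul_one_div]

-- Markov's inequality for the volume of a random set, weighting volume `s` by the cube root of the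
-- odds `s : N - s`.
theorem card_volume_eq_le (hd : ∀ v, 3 ≤ d v) (hs : s < ∑ v, d v) :
    ((Finset.univ.filter fun B : Finset V => ∑ v ∈ B, d v = s).card : ℝ) ≤
      entropyFactor (∑ v, d v) s ^ (1 / 3 : ℝ) := by
  set N := ∑ v, d v
  have hNs : (0 : ℝ) < N - s := sub_pos.2 (mod_cast hs)
  set y : ℝ := (s : ℝ) / (N - s)
  have hy : 0 ≤ y := by positivity
  set u : ℝ := y ^ (1 / 3 : ℝ)
  have hu : 0 ≤ u := by positivity
  have hu_cube : u ^ 3 = y := by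
    rw [← Real.rpow_natCast, ← Real.rpow_mul hy]; norm_num
  have hu_pow : u ^ s = (y ^ s) ^ (1 / 3 : ℝ) := by
    simp only [u, ← Real.rpow_natCast, ← Real.rpow_mul hy, mul_comm]
  have hu_pos : 0 < u ^ s := by
    rcases Nat.eq_zero_or_pos s with h | h
    · simp [h]
    · have : (0 : ℝ) < s := mod_cast h
      positivity
  refine le_of_mul_le_mul_right ?_ hu_pos
  calc _ = ∑ B with ∑ v ∈ B, d v = s, u ^ (∑ v ∈ B, d v) := by
        rw [Finset.sum_congr rfl fun B hB => by rw [(Finset.mem_filter.1 hB).2],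
          Finset.sum_const, nsmul_eq_mul]
    _ ≤ ∑ B : Finset V, u ^ (∑ v ∈ B, d v) :=
        Finset.sum_le_sum_of_subset_of_nonneg (Finset.filter_subset _ _)
          fun _ _ _ => by positivity
    _ ≤ (entropyFactor N s * y ^ s) ^ (1 / 3 : ℝ) := by
        have := sum_pow_volume_le hd hu
        rwa [hu_cube, ← entropyFactor_mul_pow hs] at this
    _ = _ := by rw [hu_pow, Real.mul_rpow (entropyFactor_pos _ _).le (by positivity)]

end Volume

section GeneratingFunction

theorem one_add_mul_le_sqrt_mul_sqrt (a b : ℝ) : 1 + a * b ≤ √(1 + a ^ 2) * √(1 + b ^ 2) := by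
  rw [← Real.sqrt_mul (by positivity)]
  exact Real.le_sqrt_of_sq_le (by nlinarith [sq_nonneg (a - b)])

theorem add_le_sqrt_mul_sqrt (a b : ℝ) : a + b ≤ √(1 + a ^ 2) * √(1 + b ^ 2) := by
  rw [← Real.sqrt_mul (by positivity)]
  exact Real.le_sqrt_of_sq_le (by nlinarith [sq_nonneg (a * b - 1)])

theorem add_mul_le_mul_exp {Q c q : ℝ} {x y : ℝ} (hQ : 1 ≤ Q) (hx : x ≤ Q) (hq : 0 ≤ q)
    (hy : y ≤ Q * c) : x + q * y ≤ Q * Real.exp (q * c) :=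
  calc x + q * y ≤ Q + q * (Q * c) := by gcongr
    _ = Q * (q * c + 1) := by ring
    _ ≤ Q * Real.exp (q * c) := by gcongr; exact Real.add_one_le_exp _

theorem uncut_add_cut_le {a b q : ℝ} (ha : 0 ≤ a) (hb : 0 ≤ b) (hq : 0 ≤ q) :
    1 + a * b + q * (a + b) ≤ √(1 + a ^ 2) * √(1 + b ^ 2) * Real.exp (q * (a + b)) := by
  have hQ := one_add_mul_le_sqrt_mul_sqrt a b
  have hQ1 : 1 ≤ √(1 + a ^ 2) * √(1 + b ^ 2) := by nlinarith
  exact add_mul_le_mul_exp hQ1 hQ hq (le_mul_of_one_le_left (by positivity) hQ1)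

theorem cut_add_uncut_le {a b q : ℝ} (ha : 0 ≤ a) (hb : 0 ≤ b) (hq : 0 ≤ q) :
    a + b + q * (1 + a * b) ≤ √(1 + a ^ 2) * √(1 + b ^ 2) * Real.exp (q * (a + b + 1)) := by
  have hQ := one_add_mul_le_sqrt_mul_sqrt a b
  have hQ1 : 1 ≤ √(1 + a ^ 2) * √(1 + b ^ 2) := by nlinarith
  refine add_mul_le_mul_exp hQ1 (add_le_sqrt_mul_sqrt a b) hq (hQ.trans ?_)
  exact le_mul_of_one_le_right (by positivity) (by linarith)

variable {H : Type*} {σ : H → H} {R : Finset H}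

/-- A set of half-edges containing exactly one end of every edge of the pairing `σ`. -/
def IsTransversal (σ : H → H) (R : Finset H) : Prop := ∀ h, σ h ∈ R ↔ h ∉ R

theorem exists_isTransversal [Finite H] (hσ : Function.Involutive σ) (hfix : ∀ h, σ h ≠ h) :
    ∃ R, IsTransversal σ R := by
  have := Fintype.ofFinite H
  let e := Fintype.equivFin H
  refine ⟨Finset.univ.filter fun h => e h < e (σ h), fun h => ?_⟩
  simp only [Finset.mem_filter_univ, hσ h, not_lt]
  exact ⟨le_of_lt, fun hle => hle.lt_of_ne fun he => hfix h (e.injective he)⟩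

variable [Fintype H]

theorem IsTransversal.prod_eq (hR : IsTransversal σ R) (hσ : Function.Involutive σ) {A : Type*}
    [CommMonoid A] (f : H → A) : ∏ h, f h = ∏ r ∈ R, f r * f (σ r) := by
  classical
  rw [← Finset.prod_mul_prod_compl R, Finset.prod_mul_distrib]
  congr 1
  exact Finset.prod_nbij' σ σ (fun h hh => (hR h).2 (Finset.mem_compl.1 hh))
    (fun r hr => Finset.mem_compl.2 fun hr' => (hR r).1 hr' hr) (fun h _ => hσ h)
    (fun h _ => hσ h) (fun h _ => by rw [hσ h])

variable [DecidableEq H]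

theorem IsTransversal.sum_prod_eq (hR : IsTransversal σ R) (hσ : Function.Involutive σ) {A : Type*}
    [CommSemiring A] (F : H → Bool × Bool → A) :
    ∑ s : H → Bool, ∏ r ∈ R, F r (s r, s (σ r)) = ∏ r ∈ R, ∑ c, F r c := by
  rw [← Finset.prod_coe_sort R fun r => ∑ c, F r c, Finset.prod_univ_sum, Fintype.piFinset_univ]
  refine Fintype.sum_equiv
    { toFun := fun s (r : R) => (s r, s (σ r))
      invFun := fun c h => if hh : h ∈ R then (c ⟨h, hh⟩).1 else (c ⟨σ h, (hR h).2 hh⟩).2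
      left_inv := fun s => ?_
      right_inv := fun c => ?_ } _ _ fun s => ?_
  · ext h
    dsimp only
    split_ifs <;> simp [hσ h]
  · ext r
    · simp
    · have hr : σ r ∉ R := fun hr => (hR r).1 hr r.2
      simp [hr, hσ _]
  · exact (Finset.prod_coe_sort R fun r => F r (s r, s (σ r))).symm

theorem sum_finset_eq_sum_bool {A : Type*} [AddCommMonoid A] (g : Finset H → A) :
    ∑ S, g S = ∑ s : H → Bool, g (Finset.univ.filter fun h => s h = true) :=
  Fintype.sum_equiv
    { toFun := fun S h => decide (h ∈ S)
      invFun := fun s => Finset.univ.filter fun h => s h = true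
      left_inv := fun S => by ext; simp
      right_inv := fun s => by ext; simp } _ _ fun S => by simp

theorem mem_edgeBoundary_apply (hσ : Function.Involutive σ) {S : Finset H} {h : H} :
    σ h ∈ edgeBoundary σ S ↔ h ∈ edgeBoundary σ S := by
  rw [mem_edgeBoundary, mem_edgeBoundary, hσ h, iff_comm (a := h ∈ S)]

theorem IsTransversal.pow_card_edgeBoundary (hR : IsTransversal σ R) (hσ : Function.Involutive σ)
    (z : ℝ) (S : Finset H) :
    z ^ (edgeBoundary σ S).card = ∏ r ∈ R, if r ∈ edgeBoundary σ S then z ^ 2 else 1 := by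
  rw [← Finset.prod_const, ← Finset.prod_ite_mem_eq, hR.prod_eq hσ]
  refine Finset.prod_congr rfl fun r _ => ?_
  simp only [mem_edgeBoundary_apply hσ, sq]
  split_ifs <;> simp

theorem sum_edge_le {a b z : ℝ} (ha : 0 ≤ a) (hb : 0 ≤ b) (t : Prop) [Decidable t] :
    ∑ c : Bool × Bool, (if c.1 then a else 1) * (if c.2 then b else 1) *
      (if c.1 = c.2 ↔ t then z ^ 2 else 1) ≤
    √(1 + a ^ 2) * √(1 + b ^ 2) * Real.exp (z ^ 2 * (a + b + if t then 1 else 0)) := by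
  simp only [Fintype.sum_prod_type, Fintype.sum_bool]
  by_cases ht : t
  · refine le_trans (le_of_eq ?_) (cut_add_uncut_le ha hb (sq_nonneg z) |>.trans_eq ?_)
    · simp only [↓reduceIte, ht, Bool.false_eq_true, mul_one, Bool.true_eq_false, iff_true,
        one_mul]
      ring
    · rw [if_pos ht]
  · refine le_trans (le_of_eq ?_) (uncut_add_cut_le ha hb (sq_nonneg z) |>.trans_eq ?_)
    · simp only [↓reduceIte, ht, iff_false, not_true_eq_false, mul_one, Bool.false_eq_true,
        Bool.true_eq_false, one_mul]
      ring
    · rw [if_neg ht, add_zero]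

-- The summands on the left factor over the edges. The four states of an edge with weights `a`, `b`
-- at its ends add up to `1 + ab + z²(a + b)` if the edge is not in the boundary of `X`, and to
-- `a + b + z²(1 + ab)` if it is.
theorem sum_prod_mul_pow_card_edgeBoundary_le (hσ : Function.Involutive σ) (hfix : ∀ h, σ h ≠ h)
    {w : H → ℝ} (hw : ∀ h, 0 ≤ w h) (z : ℝ) (X : Finset H) :
    ∑ S : Finset H, (∏ h ∈ S, w h) * z ^ (edgeBoundary σ (S ∆ X)).card ≤
      (∏ h, √(1 + w h ^ 2)) *
        Real.exp (z ^ 2 * (∑ h, w h + (edgeBoundary σ X).card / 2)) := by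
  obtain ⟨R, hR⟩ := exists_isTransversal hσ hfix
  let F (r : H) (c : Bool × Bool) : ℝ := (if c.1 then w r else 1) * (if c.2 then w (σ r) else 1) *
    if c.1 = c.2 ↔ r ∈ edgeBoundary σ X then z ^ 2 else 1
  have hF (r : H) (c : Bool × Bool) : 0 ≤ F r c := by
    have := hw r
    have := hw (σ r)
    positivity
  have hfactor (s : H → Bool) :
      (∏ h with s h = true, w h) *
        z ^ (edgeBoundary σ ((Finset.univ.filter fun h => s h = true) ∆ X)).card =
      ∏ r ∈ R, F r (s r, s (σ r)) := by
    rw [Finset.prod_filter, hR.prod_eq hσ, hR.pow_card_edgeBoundary hσ, ← Finset.prod_mul_distrib]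
    refine Finset.prod_congr rfl fun r _ => ?_
    simp only [F, edgeBoundary_symmDiff, Finset.mem_symmDiff, mem_edgeBoundary (S := {_h | _}),
      Finset.mem_filter_univ]
    congr 2
    rw [eq_iff_iff, Bool.eq_iff_iff (a := s r) (b := s (σ r))]
    tauto
  have hcard : ((edgeBoundary σ X).card : ℝ) / 2 =
      ∑ h, if h ∈ edgeBoundary σ X then 1 / 2 else 0 := by
    simp [Finset.sum_ite_mem, div_eq_mul_inv]
  calc _ = ∏ r ∈ R, ∑ c, F r c := by
        rw [sum_finset_eq_sum_bool, ← hR.sum_prod_eq hσ]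
        exact Finset.sum_congr rfl fun s _ => hfactor s
    _ ≤ ∏ r ∈ R, (√(1 + w r ^ 2) * √(1 + w (σ r) ^ 2) * Real.exp (z ^ 2 *
          (w r + w (σ r) + if r ∈ edgeBoundary σ X then 1 else 0))) :=
        Finset.prod_le_prod (fun r _ => Finset.sum_nonneg fun c _ => hF r c)
          fun r _ => sum_edge_le (hw _) (hw _) _
    _ = _ := by
        rw [hcard, ← Finset.sum_add_distrib, Finset.mul_sum, Real.exp_sum,
          ← Finset.prod_mul_distrib, hR.prod_eq hσ]
        refine Finset.prod_congr rfl fun r _ => ?_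
        rw [mul_mul_mul_comm, ← Real.exp_add]
        simp only [mem_edgeBoundary_apply hσ]
        congr 2
        split_ifs <;> ring

end GeneratingFunction

section LawInvariance

theorem uniformOfFintype_bind_equiv {X Y Z : Type*} [Fintype X] [Nonempty X] [Fintype Y]
    [Nonempty Y] (e : X ≃ Y) (g : Y → PMF Z) :
    ((PMF.uniformOfFintype X).bind fun x => g (e x)) = (PMF.uniformOfFintype Y).bind g := by
  ext z
  simp only [PMF.bind_apply, PMF.uniformOfFintype_apply, Fintype.card_congr e]
  exact e.tsum_eq fun y => ((Fintype.card Y : ℝ≥0∞))⁻¹ * g y z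

/-- Transport of perfect matchings along a bijection. -/
def PerfectMatching.congr {X Y : Type*} (e : X ≃ Y) : PerfectMatching X ≃ PerfectMatching Y :=
  e.conj.subtypeEquiv fun m => by simp [e.surjective.forall, Equiv.conj_apply]

theorem PerfectMatching.congr_apply {X Y : Type*} (e : X ≃ Y) (m : PerfectMatching X) (x : X) :
    (PerfectMatching.congr e m).1 (e x) = e (m.1 x) := by
  simp [PerfectMatching.congr, Equiv.conj_apply]

variable {X : Type*} {p : ℕ} (τ : Equiv.Perm X) (O : {O : Finset X // O.card = p})

/-- The action of a permutation on the sets of `p` half-edges. -/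
def outgoingCongr (p : ℕ) : {O : Finset X // O.card = p} ≃ {O : Finset X // O.card = p} :=
  τ.finsetCongr.subtypeEquiv fun O => by simp

theorem mem_outgoingCongr (h : X) : τ h ∈ (outgoingCongr τ p O).1 ↔ h ∈ O.1 := by
  simp [outgoingCongr]

/-- The outgoing half-edges before and after a permutation. -/
def memCongr : O.1 ≃ (outgoingCongr τ p O).1 :=
  τ.subtypeEquiv fun h => (mem_outgoingCongr τ O h).symm

/-- The internal half-edges before and after a permutation. -/
def notMemCongr : {h : X // h ∉ O.1} ≃ {h : X // h ∉ (outgoingCongr τ p O).1} :=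
  τ.subtypeEquiv fun h => (mem_outgoingCongr τ O h).symm.not

end LawInvariance

namespace TwoCommunities

section Law

variable {M : TwoCommunities.{u}} {σ : M.H → M.H}

section Invariance

variable (τ₁ : Equiv.Perm M.H₁) (τ₂ : Equiv.Perm M.H₂)

theorem conj_pairing (O₁ : M.Outgoing₁) (O₂ : M.Outgoing₂) (b : O₁.1 ≃ O₂.1)
    (m₁ : PerfectMatching (Internal₁ O₁)) (m₂ : PerfectMatching (Internal₂ O₂)) :
    (Equiv.sumCongr τ₁ τ₂).conj (pairing O₁ O₂ b m₁ m₂) =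
      pairing (outgoingCongr τ₁ M.p O₁) (outgoingCongr τ₂ M.p O₂)
        (Equiv.equivCongr (memCongr τ₁ O₁) (memCongr τ₂ O₂) b)
        (PerfectMatching.congr (notMemCongr τ₁ O₁) m₁)
        (PerfectMatching.congr (notMemCongr τ₂ O₂) m₂) := by
  funext h
  obtain ⟨h, rfl⟩ := (Equiv.sumCongr τ₁ τ₂).surjective h
  rw [Equiv.conj_apply, Equiv.symm_apply_apply]
  rcases h with h | h
  · simp only [Equiv.sumCongr_apply, Sum.map_inl, pairing, mem_outgoingCongr]
    split_ifs with hh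
    · exact congrArg (fun x => Sum.inr (memCongr τ₂ O₂ (b x)).1)
        ((memCongr τ₁ O₁).symm_apply_apply ⟨h, hh⟩).symm
    · exact congrArg (fun x => Sum.inl x.1)
        (PerfectMatching.congr_apply (notMemCongr τ₁ O₁) m₁ ⟨h, hh⟩).symm
  · simp only [Equiv.sumCongr_apply, Sum.map_inr, pairing, mem_outgoingCongr]
    split_ifs with hh
    · exact congrArg (fun x => Sum.inl (memCongr τ₁ O₁ (b.symm x)).1)
        ((memCongr τ₂ O₂).symm_apply_apply ⟨h, hh⟩).symm
    · exact congrArg (fun x => Sum.inr x.1)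
        (PerfectMatching.congr_apply (notMemCongr τ₂ O₂) m₂ ⟨h, hh⟩).symm

theorem map_conj_law : M.law.map (Equiv.sumCongr τ₁ τ₂).conj = M.law := by
  conv_rhs => rw [law, ← uniformOfFintype_bind_equiv (outgoingCongr τ₁ M.p)]
  rw [law, PMF.map_bind]
  congr 1 with O₁ : 1
  conv_rhs => rw [← uniformOfFintype_bind_equiv (outgoingCongr τ₂ M.p)]
  rw [PMF.map_bind]
  congr 1 with O₂ : 1
  conv_rhs => rw [← uniformOfFintype_bind_equiv
    (Equiv.equivCongr (memCongr τ₁ O₁) (memCongr τ₂ O₂))]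
  rw [PMF.map_bind]
  congr 1 with b : 1
  conv_rhs => rw [← uniformOfFintype_bind_equiv (PerfectMatching.congr (notMemCongr τ₁ O₁))]
  rw [PMF.map_bind]
  congr 1 with m₁ : 1
  conv_rhs => rw [PMF.map,
    ← uniformOfFintype_bind_equiv (PerfectMatching.congr (notMemCongr τ₂ O₂))]
  rw [PMF.map_comp, PMF.map]
  simp only [Function.comp_def, conj_pairing]

theorem law_conj (σ : M.H → M.H) : M.law ((Equiv.sumCongr τ₁ τ₂).conj σ) = M.law σ := by
  conv_lhs => rw [← map_conj_law τ₁ τ₂, PMF.map_apply]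
  simp

end Invariance

variable (M) in
/-- The half-edges of the first community, as a set of half-edges. -/
def leftSide : Finset M.H := {h | h.isLeft}

theorem mem_leftSide {h : M.H} : h ∈ M.leftSide ↔ h.isLeft := by simp [leftSide]

/-- The properties shared by all pairings in the support of the law: they match the half-edges, and
exactly `p` of the edges join the two communities. -/
structure IsPairing (σ : M.H → M.H) : Prop where
  involutive : Function.Involutive σ
  ne_self : ∀ h, σ h ≠ h
  card_edgeBoundary_leftSide : (edgeBoundary σ M.leftSide).card = 2 * M.p

theorem edgeBoundary_pairing_leftSide (O₁ : M.Outgoing₁) (O₂ : M.Outgoing₂) (b : O₁.1 ≃ O₂.1)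
    (m₁ : PerfectMatching (Internal₁ O₁)) (m₂ : PerfectMatching (Internal₂ O₂)) :
    edgeBoundary (pairing O₁ O₂ b m₁ m₂) M.leftSide = O₁.1.disjSum O₂.1 := by
  ext (h | h) <;> simp only [mem_edgeBoundary, mem_leftSide, pairing, Finset.inl_mem_disjSum,
    Finset.inr_mem_disjSum] <;> split_ifs with hh <;> simp [hh]

theorem isPairing_pairing (O₁ : M.Outgoing₁) (O₂ : M.Outgoing₂) (b : O₁.1 ≃ O₂.1)
    (m₁ : PerfectMatching (Internal₁ O₁)) (m₂ : PerfectMatching (Internal₂ O₂)) :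
    IsPairing (pairing O₁ O₂ b m₁ m₂) where
  involutive := by
    rintro (h | h)
    · by_cases hh : h ∈ O₁.1
      · simp [pairing, hh]
      · simp [pairing, hh, (m₁.1 ⟨h, hh⟩).2, (m₁.2 _).1]
    · by_cases hh : h ∈ O₂.1
      · simp [pairing, hh]
      · simp [pairing, hh, (m₂.1 ⟨h, hh⟩).2, (m₂.2 _).1]
  ne_self := by
    rintro (h | h)
    · by_cases hh : h ∈ O₁.1
      · simp [pairing, hh]
      · simpa [pairing, hh, Subtype.ext_iff] using (m₁.2 ⟨h, hh⟩).2
    · by_cases hh : h ∈ O₂.1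
      · simp [pairing, hh]
      · simpa [pairing, hh, Subtype.ext_iff] using (m₂.2 ⟨h, hh⟩).2
  card_edgeBoundary_leftSide := by
    rw [edgeBoundary_pairing_leftSide, Finset.card_disjSum, O₁.2, O₂.2, two_mul]

theorem isPairing_of_law_ne_zero (h : M.law σ ≠ 0) : IsPairing σ := by
  have h' : σ ∈ M.law.support := h
  simp only [law, PMF.mem_support_bind_iff, PMF.mem_support_map_iff] at h'
  obtain ⟨O₁, -, O₂, -, b, -, m₁, -, m₂, -, rfl⟩ := h'
  exact isPairing_pairing O₁ O₂ b m₁ m₂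

variable (M) in
/-- The expectation of `f` under the law of the random pairing. -/
def expect (f : (M.H → M.H) → ℝ) : ℝ := ∑ σ, (M.law σ).toReal * f σ

variable {f g : (M.H → M.H) → ℝ}

theorem expect_const (c : ℝ) : M.expect (fun _ => c) = c := by
  have hsum : ∑ σ, (M.law σ).toReal = 1 := by
    rw [← ENNReal.toReal_sum fun σ _ => PMF.apply_ne_top _ σ,
      ← tsum_fintype (L := .unconditional _), PMF.tsum_coe, ENNReal.toReal_one]
  rw [expect, ← Finset.sum_mul, hsum, one_mul]

theorem expect_mono (h : ∀ σ, IsPairing σ → f σ ≤ g σ) : M.expect f ≤ M.expect g := by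
  refine Finset.sum_le_sum fun σ _ => ?_
  by_cases hσ : M.law σ = 0
  · simp [hσ]
  · exact mul_le_mul_of_nonneg_left (h σ (isPairing_of_law_ne_zero hσ)) ENNReal.toReal_nonneg

theorem expect_sum {ι : Type*} (s : Finset ι) (f : ι → (M.H → M.H) → ℝ) :
    M.expect (fun σ => ∑ i ∈ s, f i σ) = ∑ i ∈ s, M.expect (f i) := by
  simp only [expect, Finset.mul_sum]
  exact Finset.sum_comm

theorem expect_mul_left (c : ℝ) (f : (M.H → M.H) → ℝ) :
    M.expect (fun σ => c * f σ) = c * M.expect f := by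
  simp only [expect, Finset.mul_sum, mul_left_comm]

theorem expect_conj (τ₁ : Equiv.Perm M.H₁) (τ₂ : Equiv.Perm M.H₂) (f : (M.H → M.H) → ℝ) :
    M.expect (fun σ => f ((Equiv.sumCongr τ₁ τ₂).conj σ)) = M.expect f :=
  Fintype.sum_equiv (Equiv.sumCongr τ₁ τ₂).conj _ _ fun σ => by rw [law_conj]

theorem toOuterMeasure_law_le_expect {s : Set (M.H → M.H)} (hf : 0 ≤ f)
    (h : ∀ σ ∈ s, IsPairing σ → 1 ≤ f σ) :
    M.law.toOuterMeasure s ≤ ENNReal.ofReal (M.expect f) := by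
  classical
  rw [PMF.toOuterMeasure_apply_fintype, expect,
    ENNReal.ofReal_sum_of_nonneg fun σ _ => mul_nonneg ENNReal.toReal_nonneg (hf σ)]
  refine Finset.sum_le_sum fun σ _ => Set.indicator_apply_le' (fun hσ => ?_) fun _ => zero_le
  rw [ENNReal.ofReal_mul ENNReal.toReal_nonneg, ENNReal.ofReal_toReal (PMF.apply_ne_top _ σ)]
  by_cases h0 : M.law σ = 0
  · simp [h0]
  · exact le_mul_of_one_le_right' (ENNReal.one_le_ofReal.2 (h σ hσ (isPairing_of_law_ne_zero h0)))

end Law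

end TwoCommunities

section Permutation

variable {H : Type*}

theorem exists_perm_map_eq [Finite H] {S T : Finset H} (h : S.card = T.card) :
    ∃ τ : Equiv.Perm H, S.map τ.toEmbedding = T := by
  classical
  have := Fintype.ofFinite H
  let e : {x // x ∈ S} ≃ {x // x ∈ T} := Finset.equivOfCardEq h
  refine ⟨e.extendSubtype, Finset.eq_of_subset_of_card_le (fun y hy => ?_) (by simp [h])⟩
  obtain ⟨x, hx, rfl⟩ := Finset.mem_map.1 hy
  exact e.extendSubtype_mem x hx

variable [Fintype H] [DecidableEq H]

theorem edgeBoundary_conj (e : Equiv.Perm H) (σ : H → H) (S : Finset H) :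
    edgeBoundary (e.conj σ) (S.map e.toEmbedding) = (edgeBoundary σ S).map e.toEmbedding := by
  ext h
  obtain ⟨h, rfl⟩ := e.surjective h
  simp [mem_edgeBoundary, Equiv.conj_apply]

end Permutation

namespace TwoCommunities

section CutGeneratingFunction

variable {M : TwoCommunities.{u}} {X S T : Finset M.H}

variable (M) in
/-- The sets of half-edges that the permutations within the two communities preserve. -/
def IsCommunitySet (X : Finset M.H) : Prop :=
  ∀ (τ₁ : Equiv.Perm M.H₁) (τ₂ : Equiv.Perm M.H₂),
    X.map (Equiv.sumCongr τ₁ τ₂).toEmbedding = X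

theorem isCommunitySet_empty : M.IsCommunitySet ∅ := fun _ _ => Finset.map_empty _

theorem isCommunitySet_leftSide : M.IsCommunitySet M.leftSide := fun τ₁ τ₂ => by
  ext h
  obtain ⟨h, rfl⟩ := (Equiv.sumCongr τ₁ τ₂).surjective h
  cases h <;> simp [mem_leftSide]

/-- The probability generating function of the size of the edge boundary of `S ∆ X`. -/
def cutGen (z : ℝ) (X S : Finset M.H) : ℝ := M.expect fun σ => z ^ (edgeBoundary σ (S ∆ X)).card

theorem cutGen_nonneg {z : ℝ} (hz : 0 ≤ z) (X S : Finset M.H) : 0 ≤ cutGen z X S :=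
  (expect_const 0).symm.trans_le (expect_mono fun _ _ => by positivity)

theorem cutGen_eq_of_card_eq (hX : M.IsCommunitySet X) (h₁ : S.toLeft.card = T.toLeft.card)
    (h₂ : S.toRight.card = T.toRight.card) (z : ℝ) : cutGen z X S = cutGen z X T := by
  obtain ⟨τ₁, hτ₁⟩ := exists_perm_map_eq h₁
  obtain ⟨τ₂, hτ₂⟩ := exists_perm_map_eq h₂
  have hS : S.map (Equiv.sumCongr τ₁ τ₂).toEmbedding = T := by
    rw [← T.toLeft_disjSum_toRight, ← S.toLeft_disjSum_toRight, ← hτ₁, ← hτ₂]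
    ext (h | h) <;> simp
  have hSX : (S ∆ X).map (Equiv.sumCongr τ₁ τ₂).toEmbedding = T ∆ X := by
    rw [Finset.map_eq_image, Finset.image_symmDiff _ _ (Function.Embedding.injective _),
      ← Finset.map_eq_image, ← Finset.map_eq_image, hS, hX]
  rw [cutGen, cutGen, ← expect_conj τ₁ τ₂ fun σ => z ^ (edgeBoundary σ (T ∆ X)).card]
  simp only [← hSX, edgeBoundary_conj, Finset.card_map]

theorem card_filter_card_toLeft_toRight (s₁ s₂ : ℕ) :
    (Finset.univ.filter fun S : Finset M.H => S.toLeft.card = s₁ ∧ S.toRight.card = s₂).card =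
      M.N₁.choose s₁ * M.N₂.choose s₂ := by
  rw [← card_H₁, ← card_H₂, ← Finset.card_univ, ← Finset.card_univ, ← Finset.card_powersetCard,
    ← Finset.card_powersetCard, ← Finset.card_product]
  exact Finset.card_equiv Finset.sumEquiv.toEquiv fun S => by simp [Finset.mem_powersetCard]

theorem sum_pow_mul_pow_card_edgeBoundary_le {σ : M.H → M.H} (hσ : IsPairing σ) {x y : ℝ}
    (hx : 0 ≤ x) (hy : 0 ≤ y) (z : ℝ) (X : Finset M.H) :
    ∑ S : Finset M.H, x ^ S.toLeft.card * y ^ S.toRight.card * z ^ (edgeBoundary σ (S ∆ X)).card ≤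
      √(1 + x ^ 2) ^ M.N₁ * √(1 + y ^ 2) ^ M.N₂ *
        Real.exp (z ^ 2 * (x * M.N₁ + y * M.N₂ + (edgeBoundary σ X).card / 2)) := by
  have h := sum_prod_mul_pow_card_edgeBoundary_le hσ.involutive hσ.ne_self
    (w := Sum.elim (fun _ => x) (fun _ => y)) (Sum.rec (fun _ => hx) fun _ => hy) z X
  have hprod (S : Finset M.H) : ∏ h ∈ S, Sum.elim (fun _ => x) (fun _ => y) h =
      x ^ S.toLeft.card * y ^ S.toRight.card := by
    conv_lhs => rw [← S.toLeft_disjSum_toRight]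
    simp only [Finset.prod_disjSum, Sum.elim_inl, Sum.elim_inr, Finset.prod_const]
  simpa only [hprod, Fintype.prod_sum_type, Fintype.sum_sum_type, Sum.elim_inl, Sum.elim_inr,
    Finset.prod_const, Finset.sum_const, Finset.card_univ, card_H₁, card_H₂, nsmul_eq_mul,
    mul_comm (M.N₁ : ℝ), mul_comm (M.N₂ : ℝ)] using h

-- By invariance of the law, all sets with as many half-edges in each community as `S` have the same
-- generating function; averaging over them reduces the bound to a sum over all sets.
theorem cutGen_mul_choose_le (hX : M.IsCommunitySet X) {b : ℝ}
    (hb : ∀ σ : M.H → M.H, IsPairing σ → (edgeBoundary σ X).card ≤ 2 * b) {x y z : ℝ}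
    (hx : 0 ≤ x) (hy : 0 ≤ y) (hz : 0 ≤ z) (S : Finset M.H) :
    cutGen z X S * (M.N₁.choose S.toLeft.card * M.N₂.choose S.toRight.card) *
        (x ^ S.toLeft.card * y ^ S.toRight.card) ≤
      √(1 + x ^ 2) ^ M.N₁ * √(1 + y ^ 2) ^ M.N₂ *
        Real.exp (z ^ 2 * (x * M.N₁ + y * M.N₂ + b)) := by
  let Q := Finset.univ.filter fun T : Finset M.H =>
    T.toLeft.card = S.toLeft.card ∧ T.toRight.card = S.toRight.card
  calc _ = ∑ T ∈ Q, x ^ T.toLeft.card * y ^ T.toRight.card * cutGen z X T := by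
        rw [Finset.sum_congr rfl fun T hT => show _ =
          x ^ S.toLeft.card * y ^ S.toRight.card * cutGen z X S from ?_]
        · rw [Finset.sum_const, card_filter_card_toLeft_toRight, nsmul_eq_mul]
          push_cast
          ring
        · obtain ⟨h₁, h₂⟩ := (Finset.mem_filter_univ _).1 hT
          rw [h₁, h₂, cutGen_eq_of_card_eq hX h₁ h₂]
    _ ≤ ∑ T : Finset M.H, x ^ T.toLeft.card * y ^ T.toRight.card * cutGen z X T :=
        Finset.sum_le_sum_of_subset_of_nonneg (Finset.subset_univ _) fun T _ _ =>
          mul_nonneg (by positivity) (cutGen_nonneg hz X T)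
    _ = M.expect fun σ => ∑ T : Finset M.H, x ^ T.toLeft.card * y ^ T.toRight.card *
          z ^ (edgeBoundary σ (T ∆ X)).card := by
        simp only [expect_sum, expect_mul_left, cutGen]
    _ ≤ M.expect fun _ => √(1 + x ^ 2) ^ M.N₁ * √(1 + y ^ 2) ^ M.N₂ *
          Real.exp (z ^ 2 * (x * M.N₁ + y * M.N₂ + b)) :=
        expect_mono fun σ hσ => (sum_pow_mul_pow_card_edgeBoundary_le hσ hx hy z X).trans <| by
          gcongr
          linarith [hb σ hσ]
    _ = _ := expect_const _

theorem cutGen_le (hX : M.IsCommunitySet X) {b : ℝ}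
    (hb : ∀ σ : M.H → M.H, IsPairing σ → (edgeBoundary σ X).card ≤ 2 * b) {z : ℝ} (hz : 0 ≤ z)
    (h₁ : S.toLeft.card < M.N₁) (h₂ : S.toRight.card < M.N₂) :
    cutGen z X S ≤
      (3 * S.toLeft.card + 1) * entropyFactor M.N₁ S.toLeft.card ^ (-(1 / 2) : ℝ) *
      ((3 * S.toRight.card + 1) * entropyFactor M.N₂ S.toRight.card ^ (-(1 / 2) : ℝ)) *
        Real.exp (z ^ 2 * (sqrtOdds M.N₁ S.toLeft.card * M.N₁ +
          sqrtOdds M.N₂ S.toRight.card * M.N₂ + b)) := by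
  have h := cutGen_mul_choose_le hX hb (sqrtOdds_nonneg M.N₁ S.toLeft.card)
    (sqrtOdds_nonneg M.N₂ S.toRight.card) hz S
  rw [← sqrt_entropyFactor_mul_pow h₁, ← sqrt_entropyFactor_mul_pow h₂] at h
  have hchoose : (0 : ℝ) < M.N₁.choose S.toLeft.card * M.N₂.choose S.toRight.card := by
    exact_mod_cast Nat.mul_pos (Nat.choose_pos h₁.le) (Nat.choose_pos h₂.le)
  refine le_of_mul_le_mul_right (le_of_mul_le_mul_right (h.trans ?_)
    (mul_pos (sqrtOdds_pow_pos h₁) (sqrtOdds_pow_pos h₂))) hchoose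
  have hW := mul_le_mul (sqrt_entropyFactor_le h₁.le) (sqrt_entropyFactor_le h₂.le)
    (Real.sqrt_nonneg _) ((Real.sqrt_nonneg _).trans (sqrt_entropyFactor_le h₁.le))
  have hpow := (mul_pos (sqrtOdds_pow_pos h₁) (sqrtOdds_pow_pos h₂)).le
  have := mul_le_mul_of_nonneg_right (mul_le_mul_of_nonneg_right hW hpow) (Real.exp_pos
    (z ^ 2 * (sqrtOdds M.N₁ S.toLeft.card * M.N₁ + sqrtOdds M.N₂ S.toRight.card * M.N₂ + b))).le
  linarith

end CutGeneratingFunction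

end TwoCommunities

section Tilt

/-- The expansion constant of the random pairing. With `L` the entropy of the choice of a set of
volume `s`, it is chosen so that `tilt N s ^ (expansionConst κ * s)` is at least
`Real.exp (-L / 24)`. -/
def expansionConst (κ : ℝ) : ℝ := (24 * (5 + Real.logb 2 κ⁻¹))⁻¹

theorem logb_two_inv_nonneg {κ : ℝ} (hκ : 0 < κ) (hκ1 : κ ≤ 1) : 0 ≤ Real.logb 2 κ⁻¹ :=
  Real.logb_nonneg one_lt_two ((one_le_inv₀ hκ).2 hκ1)

theorem expansionConst_pos {κ : ℝ} (hκ : 0 < κ) (hκ1 : κ ≤ 1) : 0 < expansionConst κ := by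
  have := logb_two_inv_nonneg hκ hκ1
  exact inv_pos.2 (by positivity)

theorem expansionConst_le_one {κ : ℝ} (hκ : 0 < κ) (hκ1 : κ ≤ 1) : expansionConst κ ≤ 1 :=
  inv_le_one_of_one_le₀ (by linarith [logb_two_inv_nonneg hκ hκ1])

/-- The parameter at which the generating function of the size of the edge boundary is evaluated in
the Chernoff bound for a set of volume `s` out of `N`. -/
def tilt (N s : ℕ) : ℝ := √√((s : ℝ) / N) / 16

theorem tilt_sq (N s : ℕ) : tilt N s ^ 2 = √((s : ℝ) / N) / 256 := by
  rw [tilt, div_pow, Real.sq_sqrt (Real.sqrt_nonneg _)]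
  norm_num

theorem tilt_pos {N s : ℕ} (hs : 0 < s) (hN : 0 < N) : 0 < tilt N s := by
  unfold tilt
  positivity

theorem sqrt_div_le_one {N s : ℕ} (h : s ≤ N) : √((s : ℝ) / N) ≤ 1 :=
  Real.sqrt_le_one.2 (div_le_one_of_le₀ (mod_cast h) (Nat.cast_nonneg N))

theorem tilt_le_one {N s : ℕ} (h : s ≤ N) : tilt N s ≤ 1 := by
  rw [tilt, div_le_one (by norm_num)]
  exact (Real.sqrt_le_one.2 (sqrt_div_le_one h)).trans (by norm_num)

theorem neg_log_tilt {N s : ℕ} (hs : 0 < s) (hN : 0 < N) :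
    -Real.log (tilt N s) = 4 * Real.log 2 + Real.log (N / s) / 4 := by
  have hsixteen : Real.log 16 = 4 * Real.log 2 := by
    rw [show (16 : ℝ) = 2 ^ 4 by norm_num, Real.log_pow]
    norm_num
  rw [tilt, Real.log_div (by positivity) (by norm_num), Real.log_sqrt (by positivity),
    Real.log_sqrt (by positivity), ← inv_div (s : ℝ) N, Real.log_inv, hsixteen]
  ring

variable {N₁ N₂ s₁ s₂ : ℕ}

theorem mul_log_two_le_selectionCost_add (h₁ : 2 * s₁ ≤ N₁) (h₂ : 2 * s₂ ≤ N₂) :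
    ((s₁ + s₂ : ℕ) : ℝ) * Real.log 2 ≤ selectionCost N₁ s₁ + selectionCost N₂ s₂ := by
  have cost₁ := mul_log_le_selectionCost (q := 2) two_pos (mod_cast h₁ : (2 : ℝ) * s₁ ≤ N₁)
  have cost₂ := mul_log_le_selectionCost (q := 2) two_pos (mod_cast h₂ : (2 : ℝ) * s₂ ≤ N₂)
  push_cast
  linarith

theorem selectionCost_add_le {κ : ℝ} (hκ : 0 < κ) (hκ₁ : κ * (N₁ + N₂ : ℕ) ≤ N₁)
    (hκ₂ : κ * (N₁ + N₂ : ℕ) ≤ N₂) (hN : 0 < N₁ + N₂) (hs : 0 < s₁ + s₂) :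
    selectionCost (N₁ + N₂) (s₁ + s₂) ≤
      selectionCost N₁ s₁ + selectionCost N₂ s₂ + (s₁ + s₂ : ℕ) * Real.log κ⁻¹ := by
  have hs0 : (0 : ℝ) < (s₁ + s₂ : ℕ) := mod_cast hs
  have hN0 : (0 : ℝ) < (N₁ + N₂ : ℕ) := mod_cast hN
  have cost {N s : ℕ} (hN : κ * (N₁ + N₂ : ℕ) ≤ N) (hs : s ≤ s₁ + s₂) :
      s * Real.log (κ * ((N₁ + N₂ : ℕ) / (s₁ + s₂ : ℕ))) ≤ selectionCost N s := by
    refine mul_log_le_selectionCost (by positivity) ?_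
    calc κ * ((N₁ + N₂ : ℕ) / (s₁ + s₂ : ℕ)) * s
        ≤ κ * ((N₁ + N₂ : ℕ) / (s₁ + s₂ : ℕ)) * (s₁ + s₂ : ℕ) := by gcongr
      _ = κ * (N₁ + N₂ : ℕ) := by field_simp
      _ ≤ N := hN
  have hlog : Real.log (κ * ((N₁ + N₂ : ℕ) / (s₁ + s₂ : ℕ))) =
      Real.log ((N₁ + N₂ : ℕ) / (s₁ + s₂ : ℕ)) - Real.log κ⁻¹ := by
    rw [Real.log_mul hκ.ne' (by positivity), Real.log_inv]
    ring
  have cost₁ := cost hκ₁ (Nat.le_add_right s₁ s₂)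
  have cost₂ := cost hκ₂ (Nat.le_add_left s₂ s₁)
  rw [hlog] at cost₁ cost₂
  rw [selectionCost]
  push_cast at cost₁ cost₂ ⊢
  linarith

theorem expansionConst_mul_neg_log_tilt_le {κ : ℝ} (hκ : 0 < κ) (hκ1 : κ ≤ 1)
    (hκ₁ : κ * (N₁ + N₂ : ℕ) ≤ N₁) (hκ₂ : κ * (N₁ + N₂ : ℕ) ≤ N₂) (hN : 0 < N₁ + N₂)
    (hs : 0 < s₁ + s₂) (h₁ : 2 * s₁ ≤ N₁) (h₂ : 2 * s₂ ≤ N₂) :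
    expansionConst κ * (s₁ + s₂ : ℕ) * -Real.log (tilt (N₁ + N₂) (s₁ + s₂)) ≤
      (selectionCost N₁ s₁ + selectionCost N₂ s₂) / 24 := by
  set L := selectionCost N₁ s₁ + selectionCost N₂ s₂
  have hlog2 : (s₁ + s₂ : ℕ) * Real.log 2 ≤ L := mul_log_two_le_selectionCost_add h₁ h₂
  have hlogb := logb_two_inv_nonneg hκ hκ1
  have hlogκ : (s₁ + s₂ : ℕ) * Real.log κ⁻¹ ≤ Real.logb 2 κ⁻¹ * L :=
    calc (s₁ + s₂ : ℕ) * Real.log κ⁻¹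
        = Real.logb 2 κ⁻¹ * ((s₁ + s₂ : ℕ) * Real.log 2) := by rw [Real.logb]; field_simp
      _ ≤ _ := by gcongr
  have hL : 0 ≤ L := (mul_nonneg (Nat.cast_nonneg _) (Real.log_nonneg one_le_two)).trans hlog2
  have hcost := selectionCost_add_le hκ hκ₁ hκ₂ hN hs
  rw [selectionCost] at hcost
  calc _ = expansionConst κ * (4 * ((s₁ + s₂ : ℕ) * Real.log 2) +
          (s₁ + s₂ : ℕ) * Real.log ((N₁ + N₂ : ℕ) / (s₁ + s₂ : ℕ)) / 4) := by
        rw [neg_log_tilt hs hN]; ring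
    _ ≤ expansionConst κ * ((5 + Real.logb 2 κ⁻¹) * L) := by
        refine mul_le_mul_of_nonneg_left ?_ (expansionConst_pos hκ hκ1).le
        linarith [mul_nonneg hlogb hL]
    _ = L / 24 := by
        rw [expansionConst, mul_inv, mul_assoc, inv_mul_cancel_left₀ (by positivity),
          inv_mul_eq_div]

theorem sqrt_div_mul_sqrtOdds_mul_le {N n s r : ℕ} (hr : r ≤ s) (hn : n ≤ N) (hn0 : 0 < n)
    (h : 2 * r ≤ n) : √((s : ℝ) / N) * (sqrtOdds n r * n) ≤ 3 / 2 * s := by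
  have hn0' : (0 : ℝ) < n := mod_cast hn0
  have hrs : (r : ℝ) ≤ s := mod_cast hr
  have hnr : 2 * (r : ℝ) ≤ n := mod_cast h
  have hnr0 : (0 : ℝ) < n - r := by linarith
  have hodds : (r : ℝ) / (n - r) ≤ 2 * s / n := by
    rw [div_le_div_iff₀ hnr0 hn0']
    nlinarith [r.cast_nonneg (α := ℝ)]
  have hsqrt : √((s : ℝ) / N) * sqrtOdds n r ≤ 3 / 2 * s / n := by
    rw [sqrtOdds, ← Real.sqrt_mul (by positivity)]
    refine Real.sqrt_le_iff.2 ⟨by positivity, ?_⟩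
    calc (s : ℝ) / N * (r / (n - r)) ≤ s / n * (2 * s / n) := by gcongr
      _ = 2 * (s / n) ^ 2 := by ring
      _ ≤ 9 / 4 * (s / n) ^ 2 := by gcongr; norm_num
      _ = _ := by ring
  calc _ = √((s : ℝ) / N) * sqrtOdds n r * n := by ring
    _ ≤ 3 / 2 * s / n * n := by gcongr
    _ = _ := by field_simp

theorem tilt_sq_mul_le (hN₁ : 0 < N₁) (hN₂ : 0 < N₂) (h₁ : 2 * s₁ ≤ N₁) (h₂ : 2 * s₂ ≤ N₂) :
    tilt (N₁ + N₂) (s₁ + s₂) ^ 2 *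
        (sqrtOdds N₁ s₁ * N₁ + sqrtOdds N₂ s₂ * N₂ + 2 * (s₁ + s₂ : ℕ)) ≤
      (selectionCost N₁ s₁ + selectionCost N₂ s₂) / 24 := by
  have odds₁ := sqrt_div_mul_sqrtOdds_mul_le (Nat.le_add_right s₁ s₂) (Nat.le_add_right N₁ N₂)
    hN₁ h₁
  have odds₂ := sqrt_div_mul_sqrtOdds_mul_le (Nat.le_add_left s₂ s₁) (Nat.le_add_left N₂ N₁)
    hN₂ h₂
  have hsqrt := mul_le_of_le_one_left (s₁ + s₂).cast_nonneg
    (sqrt_div_le_one (by omega : s₁ + s₂ ≤ N₁ + N₂))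
  have hlog2 : (s₁ + s₂ : ℕ) * (1 / 2 : ℝ) ≤ (s₁ + s₂ : ℕ) * Real.log 2 := by
    gcongr
    linarith [Real.log_two_gt_d9]
  have hcost := mul_log_two_le_selectionCost_add h₁ h₂
  have hs := (s₁ + s₂).cast_nonneg (α := ℝ)
  rw [tilt_sq]
  linarith

theorem exp_tilt_sq_mul_le {κ : ℝ} (hκ : 0 < κ) (hκ1 : κ ≤ 1)
    (hκ₁ : κ * (N₁ + N₂ : ℕ) ≤ N₁) (hκ₂ : κ * (N₁ + N₂ : ℕ) ≤ N₂) (hN₁ : 0 < N₁) (hN₂ : 0 < N₂)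
    (hs : 0 < s₁ + s₂) (h₁ : 2 * s₁ ≤ N₁) (h₂ : 2 * s₂ ≤ N₂) :
    Real.exp (tilt (N₁ + N₂) (s₁ + s₂) ^ 2 *
        (sqrtOdds N₁ s₁ * N₁ + sqrtOdds N₂ s₂ * N₂ + 2 * (s₁ + s₂ : ℕ))) ≤
      entropyFactor N₁ s₁ ^ (1 / 12 : ℝ) * entropyFactor N₂ s₂ ^ (1 / 12 : ℝ) *
        tilt (N₁ + N₂) (s₁ + s₂) ^ (expansionConst κ * (s₁ + s₂ : ℕ)) := by
  have hexp := tilt_sq_mul_le hN₁ hN₂ h₁ h₂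
  have hpow := expansionConst_mul_neg_log_tilt_le hκ hκ1 hκ₁ hκ₂ (by omega) hs h₁ h₂
  have hW₁ := entropyFactor_pos N₁ s₁
  have cost₁ := exp_selectionCost_mul_le (by omega : s₁ ≤ N₁) (by norm_num : (0 : ℝ) ≤ 1 / 12)
  have cost₂ := exp_selectionCost_mul_le (by omega : s₂ ≤ N₂) (by norm_num : (0 : ℝ) ≤ 1 / 12)
  calc _ ≤ Real.exp (selectionCost N₁ s₁ * (1 / 12) + selectionCost N₂ s₂ * (1 / 12) +
          Real.log (tilt (N₁ + N₂) (s₁ + s₂)) * (expansionConst κ * (s₁ + s₂ : ℕ))) :=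
        Real.exp_le_exp.2 (by linarith)
    _ ≤ _ := by
        rw [Real.exp_add, Real.exp_add, Real.rpow_def_of_pos (tilt_pos hs (by omega))]
        gcongr

end Tilt

section UnionBound

/-- The contribution of a set of volume `s` to the union bound. -/
def unionTerm (N s : ℕ) : ℝ := (3 * s + 1) * entropyFactor N s ^ (-(5 / 12) : ℝ)

theorem unionTerm_nonneg (N s : ℕ) : 0 ≤ unionTerm N s := by
  have := entropyFactor_pos N s
  unfold unionTerm
  positivity

theorem unionTerm_zero (N : ℕ) : unionTerm N 0 = 1 := by simp [unionTerm, entropyFactor_zero]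

theorem mul_entropyFactor_rpow_eq_unionTerm (N s : ℕ) :
    (3 * s + 1) * entropyFactor N s ^ (-(1 / 2) : ℝ) * entropyFactor N s ^ (1 / 12 : ℝ) =
      unionTerm N s := by
  rw [unionTerm, mul_assoc, ← Real.rpow_add (entropyFactor_pos N s)]
  norm_num

/-- A bound for the total contribution of the sets of at most half of the volume to the union
bound. -/
def unionSum (N : ℕ) : ℝ :=
  ∑ s ∈ Finset.range (N / 2 + 1), (3 * s + 1) * (((N : ℝ) / s) ^ s) ^ (-(1 / 12) : ℝ)

theorem div_pow_self_pos {N s : ℕ} (h : s ≤ N) : 0 < ((N : ℝ) / s) ^ s := by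
  rcases Nat.eq_zero_or_pos s with rfl | h0
  · simp
  · have hs : (0 : ℝ) < s := mod_cast h0
    have hN : (0 : ℝ) < N := mod_cast h0.trans_le h
    positivity

theorem two_pow_le_div_pow {N s : ℕ} (h : 2 * s ≤ N) : (2 : ℝ) ^ s ≤ ((N : ℝ) / s) ^ s := by
  rcases Nat.eq_zero_or_pos s with rfl | h0
  · simp
  · gcongr
    rw [le_div_iff₀ (mod_cast h0)]
    exact_mod_cast h

theorem sum_unionTerm_le {V : Type*} [Fintype V] {d : V → ℕ} (hd : ∀ v, 3 ≤ d v)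
    (hN : 0 < ∑ v, d v) :
    ∑ B : Finset V with 2 * ∑ v ∈ B, d v ≤ ∑ v, d v, unionTerm (∑ v, d v) (∑ v ∈ B, d v) ≤
      unionSum (∑ v, d v) := by
  classical
  set N := ∑ v, d v
  rw [← Finset.sum_fiberwise_of_maps_to (t := Finset.range (N / 2 + 1))
    (g := fun B : Finset V => ∑ v ∈ B, d v)
    (fun B hB => Finset.mem_range.2 (by have := (Finset.mem_filter.1 hB).2; omega))]
  refine Finset.sum_le_sum fun s hs => ?_
  have hsN : s < N := by
    have := Finset.mem_range.1 hs
    omega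
  have hW := entropyFactor_pos N s
  calc _ ≤ ∑ B : Finset V with ∑ v ∈ B, d v = s, unionTerm N (∑ v ∈ B, d v) :=
        Finset.sum_le_sum_of_subset_of_nonneg
          (Finset.filter_subset_filter _ (Finset.filter_subset _ _))
          fun _ _ _ => unionTerm_nonneg _ _
    _ = (Finset.univ.filter fun B : Finset V => ∑ v ∈ B, d v = s).card * unionTerm N s := by
        rw [Finset.sum_congr rfl fun B hB => by rw [(Finset.mem_filter.1 hB).2],
          Finset.sum_const, nsmul_eq_mul]
    _ ≤ entropyFactor N s ^ (1 / 3 : ℝ) * unionTerm N s :=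
        mul_le_mul_of_nonneg_right (card_volume_eq_le hd hsN) (unionTerm_nonneg N s)
    _ = (3 * s + 1) * entropyFactor N s ^ (-(1 / 12) : ℝ) := by
        rw [unionTerm, mul_left_comm, ← Real.rpow_add hW]
        norm_num
    _ ≤ _ := mul_le_mul_of_nonneg_left (Real.rpow_le_rpow_of_nonpos (div_pow_self_pos hsN.le)
        (div_pow_le_entropyFactor hsN.le) (by norm_num)) (by positivity)

theorem tendsto_mul_div_pow_rpow {s : ℕ} (hs : s ≠ 0) :
    Tendsto (fun N : ℕ => (3 * s + 1) * (((N : ℝ) / s) ^ s) ^ (-(1 / 12) : ℝ)) atTop (𝓝 0) := by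
  have hs0 : (0 : ℝ) < s := mod_cast Nat.pos_of_ne_zero hs
  have hdiv : Tendsto (fun N : ℕ => ((N : ℝ) / s) ^ s) atTop atTop :=
    (tendsto_pow_atTop hs).comp (tendsto_natCast_atTop_atTop.atTop_div_const hs0)
  simpa using ((tendsto_rpow_neg_atTop (by norm_num : (0 : ℝ) < 1 / 12)).comp hdiv).const_mul
    (3 * s + 1 : ℝ)

theorem summable_mul_geometric {ρ : ℝ} (hρ : 0 ≤ ρ) (hρ1 : ρ < 1) :
    Summable fun s : ℕ => (3 * s + 1) * ρ ^ s := by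
  have hmul : Summable fun s : ℕ => (s : ℝ) * ρ ^ s := by
    simpa using summable_pow_mul_geometric_of_norm_lt_one 1
      (by rwa [Real.norm_of_nonneg hρ] : ‖ρ‖ < 1)
  exact ((hmul.mul_left 3).add (summable_geometric_of_lt_one hρ hρ1)).congr fun s => by ring

theorem tendsto_unionSum : Tendsto unionSum atTop (𝓝 1) := by
  let ρ : ℝ := 2 ^ (-(1 / 12) : ℝ)
  have hρ : 0 ≤ ρ := by positivity
  have hρ1 : ρ < 1 := Real.rpow_lt_one_of_one_lt_of_neg one_lt_two (by norm_num)
  let F (N s : ℕ) : ℝ := if s ∈ Finset.range (N / 2 + 1) then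
    (3 * s + 1) * (((N : ℝ) / s) ^ s) ^ (-(1 / 12) : ℝ) else 0
  have hF (N : ℕ) : unionSum N = ∑' s, F N s := by
    rw [tsum_eq_sum (s := Finset.range (N / 2 + 1)) fun s hs => if_neg hs]
    exact Finset.sum_congr rfl fun s hs => (if_pos hs).symm
  rw [funext hF, ← tsum_ite_eq 0 fun _ : ℕ => (1 : ℝ)]
  refine tendsto_tsum_of_dominated_convergence (bound := fun s : ℕ => (3 * s + 1) * ρ ^ s)
    (summable_mul_geometric hρ hρ1) (fun s => ?_) (Eventually.of_forall fun N s => ?_)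
  · rcases eq_or_ne s 0 with rfl | hs
    · simp [F]
    · rw [if_neg hs]
      refine (tendsto_mul_div_pow_rpow hs).congr' ?_
      filter_upwards [eventually_ge_atTop (2 * s)] with N hN
      exact (if_pos (Finset.mem_range.2 (by omega))).symm
  · by_cases hs : s ∈ Finset.range (N / 2 + 1)
    · rw [show F N s = _ from if_pos hs, Real.norm_of_nonneg (by positivity)]
      refine mul_le_mul_of_nonneg_left ?_ (by positivity)
      have hpow := two_pow_le_div_pow (N := N) (s := s) (by have := Finset.mem_range.1 hs; omega)
      calc _ ≤ ((2 : ℝ) ^ s) ^ (-(1 / 12) : ℝ) :=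
            Real.rpow_le_rpow_of_nonpos (by positivity) hpow (by norm_num)
        _ = ρ ^ s := by
            rw [← Real.rpow_natCast, ← Real.rpow_natCast, ← Real.rpow_mul two_pos.le,
              ← Real.rpow_mul two_pos.le, mul_comm]
    · rw [show F N s = 0 from if_neg hs, norm_zero]
      positivity

end UnionBound

namespace TwoCommunities

section Chernoff

variable {M : TwoCommunities.{u}} {X S : Finset M.H} {κ : ℝ}

theorem cutGen_tilt_le (hκ : 0 < κ) (hκ1 : κ ≤ 1) (hκ₁ : κ * M.N ≤ M.N₁) (hκ₂ : κ * M.N ≤ M.N₂)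
    (hX : M.IsCommunitySet X)
    (hXS : ∀ σ : M.H → M.H, IsPairing σ → (edgeBoundary σ X).card ≤ 4 * S.card) (hS : S.Nonempty)
    (h₁ : 2 * S.toLeft.card ≤ M.N₁) (h₂ : 2 * S.toRight.card ≤ M.N₂) :
    cutGen (tilt M.N S.card) X S ≤ unionTerm M.N₁ S.toLeft.card * unionTerm M.N₂ S.toRight.card *
      tilt M.N S.card ^ (expansionConst κ * S.card) := by
  have hN₁ := M.N₁_pos
  have hN₂ := M.N₂_pos
  have hs := hS.card_pos
  have hXS' (σ : M.H → M.H) (hσ : IsPairing σ) :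
      ((edgeBoundary σ X).card : ℝ) ≤ 2 * (2 * S.card) := by
    rw [← mul_assoc]
    exact_mod_cast hXS σ hσ
  rw [← S.card_toLeft_add_card_toRight] at hs hXS' ⊢
  have hexp := exp_tilt_sq_mul_le hκ hκ1 hκ₁ hκ₂ hN₁ hN₂ hs h₁ h₂
  have hW₁ := entropyFactor_pos M.N₁ S.toLeft.card
  have hW₂ := entropyFactor_pos M.N₂ S.toRight.card
  refine (cutGen_le hX hXS' (tilt_pos hs M.N_pos).le (by omega) (by omega)).trans <|
    (mul_le_mul_of_nonneg_left hexp (by positivity)).trans (le_of_eq ?_)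
  rw [← mul_entropyFactor_rpow_eq_unionTerm, ← mul_entropyFactor_rpow_eq_unionTerm, N]
  ring

theorem toOuterMeasure_card_edgeBoundary_lt_le (hκ : 0 < κ) (hκ1 : κ ≤ 1)
    (hκ₁ : κ * M.N ≤ M.N₁) (hκ₂ : κ * M.N ≤ M.N₂) (hX : M.IsCommunitySet X)
    (hXS : ∀ σ : M.H → M.H, IsPairing σ → (edgeBoundary σ X).card ≤ 4 * S.card) (hS : S.Nonempty)
    (h₁ : 2 * S.toLeft.card ≤ M.N₁) (h₂ : 2 * S.toRight.card ≤ M.N₂) :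
    M.law.toOuterMeasure {σ | (edgeBoundary σ (S ∆ X)).card < expansionConst κ * S.card} ≤
      ENNReal.ofReal (unionTerm M.N₁ S.toLeft.card * unionTerm M.N₂ S.toRight.card) := by
  set z := tilt M.N S.card
  set E := expansionConst κ * S.card
  have hz : 0 < z := tilt_pos hS.card_pos M.N_pos
  have hz1 : z ≤ 1 := tilt_le_one (by
    rw [← S.card_toLeft_add_card_toRight, N]
    omega)
  have hzE : 0 < z ^ E := Real.rpow_pos_of_pos hz E
  calc _ ≤ ENNReal.ofReal (M.expect fun σ => (z ^ E)⁻¹ * z ^ (edgeBoundary σ (S ∆ X)).card) := by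
        refine toOuterMeasure_law_le_expect (fun σ => by positivity) fun σ hσ _ => ?_
        rw [← div_eq_inv_mul, one_le_div hzE, ← Real.rpow_natCast]
        exact Real.rpow_le_rpow_of_exponent_ge hz hz1 (le_of_lt hσ)
    _ = ENNReal.ofReal ((z ^ E)⁻¹ * cutGen z X S) := by rw [expect_mul_left, cutGen]
    _ ≤ _ := by
        refine ENNReal.ofReal_le_ofReal ?_
        rw [← div_eq_inv_mul, div_le_iff₀ hzE]
        exact cutGen_tilt_le hκ hκ1 hκ₁ hκ₂ hX hXS hS h₁ h₂

end Chernoff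

section Expansion

variable {M : TwoCommunities.{u}} {S : Finset M.H} {B : Finset M.V} {σ : M.H → M.H} {ε κ : ℝ}

theorem toLeft_leftSide : M.leftSide.toLeft = Finset.univ := by
  ext
  simp [mem_leftSide]

theorem toRight_leftSide : M.leftSide.toRight = ∅ := by
  ext
  simp [mem_leftSide]

theorem card_leftSide : M.leftSide.card = M.N₁ := by
  rw [← M.leftSide.card_toLeft_add_card_toRight, toLeft_leftSide, toRight_leftSide,
    Finset.card_univ, Finset.card_empty, card_H₁, add_zero]

theorem card_leftSide_compl : M.leftSideᶜ.card = M.N₂ := by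
  rw [Finset.card_compl, card_H, card_leftSide, N, Nat.add_sub_cancel_left]

theorem smallInHalves_leftSide_iff :
    SmallInHalves M.leftSide S ↔ 2 * S.toLeft.card ≤ M.N₁ ∧ 2 * S.toRight.card ≤ M.N₂ := by
  have hleft : (S ∩ M.leftSide).card = S.toLeft.card := by
    rw [← (S ∩ M.leftSide).card_toLeft_add_card_toRight, Finset.toLeft_inter,
      Finset.toRight_inter, toLeft_leftSide, toRight_leftSide]
    simp
  have hright : (S ∩ M.leftSideᶜ).card = S.toRight.card := by
    rw [← Finset.sdiff_eq_inter_compl, Finset.card_sdiff, Finset.inter_comm, hleft,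
      ← S.card_toLeft_add_card_toRight, Nat.add_sub_cancel_left]
  rw [SmallInHalves, hleft, hright, card_leftSide, card_leftSide_compl]

theorem card_toLeft_halfEdges (B : Finset M.V) :
    (halfEdges M.vertex B).toLeft.card = ∑ v ∈ B.toLeft, M.d₁ v := by
  have h : (halfEdges M.vertex B).toLeft = B.toLeft.sigma fun _ => Finset.univ := by
    ext
    simp [mem_halfEdges, vertex]
  simp [h]

theorem card_toRight_halfEdges (B : Finset M.V) :
    (halfEdges M.vertex B).toRight.card = ∑ v ∈ B.toRight, M.d₂ v := by
  have h : (halfEdges M.vertex B).toRight = B.toRight.sigma fun _ => Finset.univ := by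
    ext
    simp [mem_halfEdges, vertex]
  simp [h]

theorem halfEdges_nonempty (hB : B.Nonempty) : (halfEdges M.vertex B).Nonempty := by
  rw [← Finset.card_pos, card_halfEdges]
  exact Finset.sum_pos (fun v _ => two_pos.trans_le (two_le_d v)) hB

theorem exists_halfEdges_eq_symmDiff_leftSide (A : Finset M.V) :
    ∃ B, halfEdges M.vertex B = halfEdges M.vertex A ∆ M.leftSide := by
  refine ⟨A ∆ Finset.univ.filter (·.isLeft), ?_⟩
  ext (h | h) <;> simp [mem_halfEdges, Finset.mem_symmDiff, mem_leftSide, vertex]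

/-- Expansion of `S` and of its twist `S ∆ leftSide`. The latter is only required if `S` is not too
small, since otherwise most of the `2 * p` boundary half-edges of `leftSide` stay in the boundary of
the twist. -/
structure Expands (ε : ℝ) (σ : M.H → M.H) (S : Finset M.H) : Prop where
  aligned : ε * S.card ≤ (edgeBoundary σ S).card
  twisted : M.p ≤ 2 * S.card → ε * S.card ≤ (edgeBoundary σ (S ∆ M.leftSide)).card

/-- The good event: all vertex sets of volume at most half in both communities expand. -/
def IsExpanding (ε : ℝ) (σ : M.H → M.H) : Prop :=
  ∀ B, SmallInHalves M.leftSide (halfEdges M.vertex B) → Expands ε σ (halfEdges M.vertex B)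

theorem Expands.mul_add_card_le (hS : Expands ε σ S) (hσ : IsPairing σ) (hε : 0 < ε)
    (hε1 : ε ≤ 1) :
    ε / 3 * (M.p + S.card) ≤ (edgeBoundary σ (S ∆ M.leftSide)).card := by
  rcases le_or_gt M.p (2 * S.card) with hp | hp
  · have hp' : (M.p : ℝ) ≤ 2 * S.card := mod_cast hp
    calc ε / 3 * (M.p + S.card) ≤ ε / 3 * (2 * S.card + S.card) := by gcongr
      _ = ε * S.card := by ring
      _ ≤ _ := hS.twisted hp
  · have hboundary : 2 * M.p ≤ (edgeBoundary σ (S ∆ M.leftSide)).card + 2 * S.card := by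
      rw [← hσ.card_edgeBoundary_leftSide]
      exact (card_edgeBoundary_le_add σ S _).trans
        (Nat.add_le_add_left (card_edgeBoundary_le hσ.involutive.injective S) _)
    calc ε / 3 * (M.p + S.card) ≤ 1 / 3 * (M.p + M.p) := by
          gcongr
          omega
      _ ≤ M.p := by linarith [M.p.cast_nonneg (α := ℝ)]
      _ ≤ _ := Nat.cast_le.2 (by omega)

theorem IsExpanding.expandsAcross (hexp : IsExpanding ε σ) (hσ : IsPairing σ) (hε : 0 < ε)
    (hε1 : ε ≤ 1) : ExpandsAcross σ M.vertex M.leftSide M.p (ε / 3) where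
  aligned A hA := by
    refine le_trans ?_ (hexp A hA).aligned
    gcongr
    linarith
  twisted A hA := by
    obtain ⟨B, hB⟩ := exists_halfEdges_eq_symmDiff_leftSide A
    rw [← hB] at hA ⊢
    have h := (hexp B hA).mul_add_card_le hσ hε hε1
    rwa [hB, symmDiff_symmDiff_cancel_right, ← hB] at h

theorem IsExpanding.poincare (hexp : IsExpanding ε σ) (hσ : IsPairing σ) (hε : 0 < ε)
    (hε1 : ε ≤ 1) {f : M.V → ℝ} (hf : 0 ≤ f)
    (hsupp : 2 * (Finset.univ.filter fun h => f (M.vertex h) ≠ 0).card ≤ M.N) :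
    ε ^ 2 / 2808 * (M.p / M.N) * ∑ h, f (M.vertex h) ^ 2 ≤
      ∑ h, (f (M.vertex h) - f (M.vertex (σ h))) ^ 2 := by
  have hacross := hexp.expandsAcross hσ hε hε1
  have hp : M.p ≤ Fintype.card M.H := by
    rw [card_H]
    exact M.p_le_N₁.trans (Nat.le_add_right _ _)
  have hconst : (ε / 3) ^ 2 / 312 = ε ^ 2 / 2808 := by ring
  rw [← hconst, ← card_H]
  have hsplit : (M.leftSide.filter fun h => f (M.vertex h) ≠ 0).card +
      (M.leftSideᶜ.filter fun h => f (M.vertex h) ≠ 0).card =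
      (Finset.univ.filter fun h => f (M.vertex h) ≠ 0).card := by
    rw [← Finset.card_union_of_disjoint (Finset.disjoint_filter_filter disjoint_compl_right),
      ← Finset.filter_union, Finset.union_compl]
  rcases le_or_gt (2 * (M.leftSideᶜ.filter fun h => f (M.vertex h) ≠ 0).card) M.N₂
    with hright | hright
  · exact hacross.poincare (by linarith) (by linarith)
      (Finset.card_pos.1 (by rw [card_leftSide]; exact N₁_pos)) hp hf
      (by rwa [card_leftSide_compl])
  · refine hacross.compl.poincare (by linarith) (by linarith)
      (Finset.card_pos.1 (by rw [card_leftSide_compl]; exact N₂_pos)) hp hf ?_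
    rw [compl_compl, card_leftSide]
    rw [N] at hsupp
    omega

theorem α_nonneg : 0 ≤ M.α := by
  unfold α
  positivity

theorem α_le_two : M.α ≤ 2 := by
  have h₁ : (M.p : ℝ) / M.N₁ ≤ 1 := div_le_one_of_le₀ (mod_cast M.p_le_N₁) (Nat.cast_nonneg _)
  have h₂ : (M.p : ℝ) / M.N₂ ≤ 1 := div_le_one_of_le₀ (mod_cast M.p_le_N₂) (Nat.cast_nonneg _)
  rw [α]
  linarith

theorem half_mul_α_le (hκ : 0 < κ) (hκ₁ : κ * M.N ≤ M.N₁) (hκ₂ : κ * M.N ≤ M.N₂) :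
    κ / 2 * M.α ≤ M.p / M.N := by
  have hN : (0 : ℝ) < M.N := Nat.cast_pos.2 N_pos
  have hκN : 0 < κ * M.N := by positivity
  calc κ / 2 * M.α ≤ κ / 2 * (M.p / (κ * M.N) + M.p / (κ * M.N)) := by
        unfold α
        gcongr
    _ = M.p / M.N := by
        field_simp
        ring

theorem IsExpanding.le_spectralProfile (hexp : IsExpanding ε σ) (hσ : IsPairing σ) (hε : 0 < ε)
    (hε1 : ε ≤ 1) (hκ : 0 < κ) (hκ1 : κ ≤ 1) (hκ₁ : κ * M.N ≤ M.N₁) (hκ₂ : κ * M.N ≤ M.N₂)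
    (hn : 2 ≤ M.n) :
    ε ^ 2 * κ / 22464 * M.α ≤ spectralProfile (lazyWalk σ) M.stationary (1 / 2) := by
  refine le_spectralProfile_of_poincare hσ.involutive.bijective hn ?_ fun f hf hsupp => ?_
  · calc ε ^ 2 * κ / 22464 * M.α ≤ 1 ^ 2 * 1 / 22464 * 2 := by
          gcongr
          exacts [α_nonneg, α_le_two]
      _ ≤ 1 := by norm_num
  · refine le_trans ?_ (hexp.poincare hσ hε hε1 hf hsupp)
    refine mul_le_mul_of_nonneg_right ?_ (Finset.sum_nonneg fun h _ => sq_nonneg _)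
    calc 4 * (ε ^ 2 * κ / 22464 * M.α) = ε ^ 2 / 2808 * (κ / 2 * M.α) := by ring
      _ ≤ _ := by
          gcongr
          exact half_mul_α_le hκ hκ₁ hκ₂

end Expansion

section Probability

variable {M : TwoCommunities.{u}} {B : Finset M.V} {κ : ℝ}

variable (M) in
/-- The sets of vertices of volume at most half in both communities. -/
def halfVolumeSets : Finset (Finset M.V) :=
  {B | 2 * ∑ v ∈ B.toLeft, M.d₁ v ≤ M.N₁ ∧ 2 * ∑ v ∈ B.toRight, M.d₂ v ≤ M.N₂}

theorem mem_halfVolumeSets :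
    B ∈ M.halfVolumeSets ↔ SmallInHalves M.leftSide (halfEdges M.vertex B) := by
  simp [halfVolumeSets, smallInHalves_leftSide_iff, card_toLeft_halfEdges, card_toRight_halfEdges]

/-- The contribution of a set of vertices to the union bound. -/
def setTerm (B : Finset M.V) : ℝ :=
  unionTerm M.N₁ (∑ v ∈ B.toLeft, M.d₁ v) * unionTerm M.N₂ (∑ v ∈ B.toRight, M.d₂ v)

theorem setTerm_nonneg (B : Finset M.V) : 0 ≤ setTerm B :=
  mul_nonneg (unionTerm_nonneg _ _) (unionTerm_nonneg _ _)

theorem setTerm_empty : setTerm (∅ : Finset M.V) = 1 := by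
  simp [setTerm, unionTerm_zero, Finset.toLeft_eq_empty.2, Finset.toRight_eq_empty.2]

theorem sum_setTerm_le (hd : ∀ v, 3 ≤ M.d v) :
    ∑ B ∈ M.halfVolumeSets, setTerm B ≤ unionSum M.N₁ * unionSum M.N₂ := by
  calc _ = ∑ x ∈ (Finset.univ.filter fun B : Finset M.V₁ => 2 * ∑ v ∈ B, M.d₁ v ≤ M.N₁) ×ˢ
          (Finset.univ.filter fun B : Finset M.V₂ => 2 * ∑ v ∈ B, M.d₂ v ≤ M.N₂),
          unionTerm M.N₁ (∑ v ∈ x.1, M.d₁ v) * unionTerm M.N₂ (∑ v ∈ x.2, M.d₂ v) :=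
        Finset.sum_equiv Finset.sumEquiv.toEquiv
          (fun B => by simp [halfVolumeSets, Finset.sumEquiv]) fun B _ => rfl
    _ ≤ _ := by
        simp only [Finset.sum_product, ← Finset.sum_mul_sum]
        exact mul_le_mul (sum_unionTerm_le (fun v => hd (Sum.inl v)) M.N₁_pos)
          (sum_unionTerm_le (fun v => hd (Sum.inr v)) M.N₂_pos)
          (Finset.sum_nonneg fun _ _ => unionTerm_nonneg _ _)
          (Finset.sum_nonneg fun _ _ => by positivity)

theorem toOuterMeasure_not_expands_le (hκ : 0 < κ) (hκ1 : κ ≤ 1) (hκ₁ : κ * M.N ≤ M.N₁)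
    (hκ₂ : κ * M.N ≤ M.N₂) (hB : B.Nonempty) (hsmall : B ∈ M.halfVolumeSets) :
    M.law.toOuterMeasure {σ | ¬Expands (expansionConst κ) σ (halfEdges M.vertex B)} ≤
      ENNReal.ofReal (2 * setTerm B) := by
  set S := halfEdges M.vertex B
  have hS : S.Nonempty := halfEdges_nonempty hB
  obtain ⟨h₁, h₂⟩ := smallInHalves_leftSide_iff.1 (mem_halfVolumeSets.1 hsmall)
  have hterm (X : Finset M.H) (hX : M.IsCommunitySet X)
      (hXS : ∀ σ : M.H → M.H, IsPairing σ → (edgeBoundary σ X).card ≤ 4 * S.card) :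
      M.law.toOuterMeasure {σ | (edgeBoundary σ (S ∆ X)).card < expansionConst κ * S.card} ≤
        ENNReal.ofReal (setTerm B) := by
    rw [setTerm, ← card_toLeft_halfEdges, ← card_toRight_halfEdges]
    exact toOuterMeasure_card_edgeBoundary_lt_le hκ hκ1 hκ₁ hκ₂ hX hXS hS h₁ h₂
  have haligned := hterm ∅ isCommunitySet_empty fun σ _ => by simp [edgeBoundary]
  have htwisted : M.law.toOuterMeasure {σ | M.p ≤ 2 * S.card ∧
      (edgeBoundary σ (S ∆ M.leftSide)).card < expansionConst κ * S.card} ≤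
        ENNReal.ofReal (setTerm B) := by
    by_cases hp : M.p ≤ 2 * S.card
    · simpa only [hp, true_and] using hterm M.leftSide isCommunitySet_leftSide fun σ hσ => by
        rw [hσ.card_edgeBoundary_leftSide]
        omega
    · simp [hp]
  rw [two_mul, ENNReal.ofReal_add (setTerm_nonneg B) (setTerm_nonneg B)]
  refine (MeasureTheory.measure_mono fun σ hσ => ?_).trans <|
    (MeasureTheory.measure_union_le _ _).trans (add_le_add haligned htwisted)
  by_contra hc
  simp only [Set.mem_union, Set.mem_ofPred_eq, not_or, not_and, not_lt] at hc
  exact hσ ⟨by simpa only [← Finset.bot_eq_empty, symmDiff_bot] using hc.1, hc.2⟩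

theorem toOuterMeasure_not_isExpanding_le (hκ : 0 < κ) (hκ1 : κ ≤ 1) (hκ₁ : κ * M.N ≤ M.N₁)
    (hκ₂ : κ * M.N ≤ M.N₂) (hd : ∀ v, 3 ≤ M.d v) :
    M.law.toOuterMeasure {σ | ¬IsExpanding (expansionConst κ) σ} ≤
      ENNReal.ofReal (2 * (unionSum M.N₁ * unionSum M.N₂ - 1)) := by
  have hempty : ∅ ∈ M.halfVolumeSets := by
    simp [mem_halfVolumeSets, halfEdges, SmallInHalves]
  calc _ ≤ M.law.toOuterMeasure (⋃ B ∈ M.halfVolumeSets.erase ∅,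
          {σ | ¬Expands (expansionConst κ) σ (halfEdges M.vertex B)}) := by
        refine MeasureTheory.measure_mono fun σ hσ => ?_
        simp only [Set.mem_ofPred_eq, IsExpanding, not_forall] at hσ
        obtain ⟨B, hsmall, hB⟩ := hσ
        have hne : B ≠ ∅ := by
          rintro rfl
          exact hB ⟨by simp [halfEdges], by simp [halfEdges]⟩
        exact Set.mem_biUnion (Finset.mem_erase.2 ⟨hne, mem_halfVolumeSets.2 hsmall⟩) hB
    _ ≤ ∑ B ∈ M.halfVolumeSets.erase ∅,
          M.law.toOuterMeasure {σ | ¬Expands (expansionConst κ) σ (halfEdges M.vertex B)} :=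
        MeasureTheory.measure_biUnion_finset_le _ _
    _ ≤ ∑ B ∈ M.halfVolumeSets.erase ∅, ENNReal.ofReal (2 * setTerm B) :=
        Finset.sum_le_sum fun B hB => toOuterMeasure_not_expands_le hκ hκ1 hκ₁ hκ₂
          (Finset.nonempty_iff_ne_empty.2 (Finset.ne_of_mem_erase hB)) (Finset.mem_of_mem_erase hB)
    _ = ENNReal.ofReal (2 * (∑ B ∈ M.halfVolumeSets, setTerm B - 1)) := by
        rw [← ENNReal.ofReal_sum_of_nonneg fun B _ => mul_nonneg zero_le_two (setTerm_nonneg B),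
          ← Finset.mul_sum, Finset.sum_erase_eq_sub hempty, setTerm_empty]
    _ ≤ _ := by gcongr; exact sum_setTerm_le hd

theorem one_sub_le_toOuterMeasure_le_spectralProfile (hκ : 0 < κ) (hκ1 : κ ≤ 1)
    (hκ₁ : κ * M.N ≤ M.N₁) (hκ₂ : κ * M.N ≤ M.N₂) (hd : ∀ v, 3 ≤ M.d v) (hn : 2 ≤ M.n) :
    1 - ENNReal.ofReal (2 * (unionSum M.N₁ * unionSum M.N₂ - 1)) ≤
      M.law.toOuterMeasure {σ | expansionConst κ ^ 2 * κ / 22464 * M.α ≤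
        spectralProfile (lazyWalk σ) M.stationary (1 / 2)} := by
  set E : Set (M.H → M.H) := {σ | IsExpanding (expansionConst κ) σ}
  have hone : 1 ≤ M.law.toOuterMeasure E + M.law.toOuterMeasure Eᶜ :=
    calc 1 = M.law.toOuterMeasure Set.univ :=
          ((PMF.toOuterMeasure_apply_eq_one_iff _ _).2 (Set.subset_univ _)).symm
      _ ≤ _ := by
          rw [← Set.union_compl_self E]
          exact MeasureTheory.measure_union_le _ _
  have hE : M.law.toOuterMeasure E ≤ M.law.toOuterMeasure
      {σ | expansionConst κ ^ 2 * κ / 22464 * M.α ≤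
        spectralProfile (lazyWalk σ) M.stationary (1 / 2)} :=
    PMF.toOuterMeasure_mono _ fun σ hσ => hσ.1.le_spectralProfile (isPairing_of_law_ne_zero hσ.2)
      (expansionConst_pos hκ hκ1) (expansionConst_le_one hκ hκ1) hκ hκ1 hκ₁ hκ₂ hn
  rw [tsub_le_iff_right]
  exact hone.trans (add_le_add hE (toOuterMeasure_not_isExpanding_le hκ hκ1 hκ₁ hκ₂ hd))

end Probability

end TwoCommunities

theorem tendsto_one_sub_unionSum {N₁ N₂ : ℕ → ℕ} (h₁ : Tendsto N₁ atTop atTop)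
    (h₂ : Tendsto N₂ atTop atTop) :
    Tendsto (fun k => 1 - ENNReal.ofReal (2 * (unionSum (N₁ k) * unionSum (N₂ k) - 1)))
      atTop (𝓝 1) := by
  have hprod := (((tendsto_unionSum.comp h₁).mul (tendsto_unionSum.comp h₂)).sub_const 1).const_mul
    (2 : ℝ)
  have hsub := ENNReal.Tendsto.sub (tendsto_const_nhds (x := (1 : ℝ≥0∞)))
    (ENNReal.tendsto_ofReal hprod) (Or.inl ENNReal.one_ne_top)
  simpa using hsub

theorem proposition4p8_general (κ : ℝ) (hκ : 0 < κ) :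
    ∃ c : ℝ, 0 < c ∧ ∀ M : ℕ → TwoCommunities.{u},
      Tendsto (fun k => (M k).n) atTop atTop →
      (∀ k, κ * (M k).N ≤ (M k).N₁ ∧ κ * (M k).N ≤ (M k).N₂) →
      (∀ k v, 3 ≤ (M k).d v) →
      Tendsto (fun k => (M k).law.toOuterMeasure
        {σ | c * (M k).α ≤
          spectralProfile (TwoCommunities.lazyWalk σ) (M k).stationary (1 / 2)})
        atTop (𝓝 1) := by
  set κ' := min κ 1
  have hκ' : 0 < κ' := lt_min hκ one_pos
  have hκ1 : κ' ≤ 1 := min_le_right κ 1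
  have hε := expansionConst_pos hκ' hκ1
  refine ⟨expansionConst κ' ^ 2 * κ' / 22464, by positivity, fun M hn hN hd => ?_⟩
  have hN₁ (k) : κ' * (M k).N ≤ (M k).N₁ := le_trans (by gcongr; exact min_le_left κ 1) (hN k).1
  have hN₂ (k) : κ' * (M k).N ≤ (M k).N₂ := le_trans (by gcongr; exact min_le_left κ 1) (hN k).2
  have hκN : Tendsto (fun k => κ' * ((M k).N : ℝ)) atTop atTop :=
    (tendsto_natCast_atTop_atTop.comp
      (tendsto_atTop_mono (fun _ => TwoCommunities.n_le_N) hn)).const_mul_atTop hκ'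
  have hlim := tendsto_one_sub_unionSum
    (tendsto_natCast_atTop_iff.1 (tendsto_atTop_mono hN₁ hκN))
    (tendsto_natCast_atTop_iff.1 (tendsto_atTop_mono hN₂ hκN))
  refine tendsto_of_tendsto_of_tendsto_of_le_of_le' hlim tendsto_const_nhds ?_
    (Eventually.of_forall fun k => ?_)
  · filter_upwards [hn.eventually_ge_atTop 2] with k hk
    exact TwoCommunities.one_sub_le_toOuterMeasure_le_spectralProfile hκ' hκ1 (hN₁ k) (hN₂ k)
      (hd k) hk
  · exact (MeasureTheory.measure_mono (Set.subset_univ _)).trans_eq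
      ((PMF.toOuterMeasure_apply_eq_one_iff _ _).2 (Set.subset_univ _))

end

theorem proposition4p8 (Δ : ℕ) (κ a : ℝ) (hκ : 0 < κ) (ha : 0 < a) :
    ∃ c : ℝ, 0 < c ∧ ∀ M : ℕ → TwoCommunities.{u},
      Tendsto (fun k => (M k).n) atTop atTop →
      (∀ k, (M k).α ≤ 1) →
      (∀ k, κ * (M k).N ≤ (M k).N₁ ∧ κ * (M k).N ≤ (M k).N₂) →
      (∀ k v, 3 ≤ (M k).d v) →
      (∀ k v, (M k).d v ≤ Δ) →
      (∀ k, a / Real.log (M k).n ≤ (M k).α) →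
      Tendsto (fun k => (M k).law.toOuterMeasure
        {σ | c * (M k).α ≤
          spectralProfile (TwoCommunities.lazyWalk σ) (M k).stationary (1 / 2)})
        atTop (𝓝 1) := by
  obtain ⟨c, hc, h⟩ := proposition4p8_general.{u} κ hκ
  exact ⟨c, hc, fun M hn _ hN hd _ _ => h M hn hN hd⟩
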